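/- Let $M$ be a smooth (Hausdorff, second countable, finite-dimensional, boundaryless) manifold and let $\Omega(M)=\bigoplus_k\Omega^k(M)$ be its exterior algebra of smooth differential forms, with product the wedge product. A \emph{metric} on $M$ is a smooth nondegenerate symmetric $(0,2)$-tensor field $g$ (of any signature); write $(\ ,\ )_g$ for the inverse metric on $1$-forms. A \emph{BV algebra structure} on $\Omega(M)$ is an $\mathbb R$-linear map $\delta:\Omega(M)\to\Omega(M)$ that lowers degree by $1$ (and vanishes on $\Omega^0(M)=C^\infty(M)$), with $\delta^2=0$, obeying the 7-term identity \[ \delta(\omega\eta\zeta)=(\delta(\omega\eta))\zeta+(-1)^{|\omega|}\omega\,\delta(\eta\zeta)+(-1)^{(|\omega|-1)|\eta|}\eta\,\delta(\omega\zeta)-(\delta\omega)\eta\zeta-(-1)^{|\omega|}\omega(\delta\eta)\zeta-(-1)^{|\omega|+|\eta|}\omega\eta\,\delta\zeta \] for all homogeneous $\omega,\eta$ and all $\zeta$ in $\Omega(M)$. It is \emph{symmetric} if $\delta(a\,{\rm d}b)-a\,\delta{\rm d}b=\delta(b\,{\rm d}a)-b\,\delta{\rm d}a$ for all $a,b\in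 C^\infty(M)$. Its \emph{associated bilinear form} on $1$-forms is given by $(\omega,{\rm d}a)=\delta(a\omega)-a\,\delta\omega$ for $a\in C^\infty(M)$, $\omega\in\Omega^1(M)$; it is \emph{nondegenerate} if for every $x\in M$ and $\omega\in\Omega^1(M)$, $(\omega,{\rm d}a)(x)=0$ for all $a$ implies $\omega_x=0$, and \emph{positive definite} if $({\rm d}a,{\rm d}a)(x)>0$ whenever ${\rm d}a_x\ne0$. Then $M$ admits a metric if and only if $\Omega(M)$ admits a symmetric BV algebra structure with nondegenerate associated bilinear form; and $M$ admits a positive definite metric if and only if it admits such a structure with positive definite associated bilinear form. More precisely: (a) For every symmetric BV algebra structure $\delta$ with nondegenerate associated bilinear form there is a unique metric $g$ on $M$ with $\delta(a\omega)-a\,\delta\omega=(\omega,{\rm d}a)_g$ for all $a\in C^\infty(M)$, $\omega\in\Omega^1(M)$; this $g$ is positive definite if and only if the associated bilinear form is. (b) For every metric $g$ on $M$ there is a unique linear map $\delta$ on $\Omega(M)$ that is the codifferential (divergence) of $g$, i.e. is given in every smooth chart by $\delta\omega=\sum_{i,j}g^{ij}\,\iota_{\partial_i}\nabla_{\partial_j}\omega$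 with $\nabla$ the Levi-Civita connection of $g$ (so that $\delta\omega=\operatorname{div}(\omega^\sharp)$ on $1$-forms). This $\delta$ is a symmetric BV algebra structure, in particular obeys the 7-term identity, its associated bilinear form is nondegenerate, and $\delta(a\omega)-a\,\delta\omega=(\omega,{\rm d}a)_g$ for all $a\in C^\infty(M)$, $\omega\in\Omega^1(M)$. -/

import Mathlib

open scoped Manifold ContDiff

noncomputable section

namespace BVGeom

/-! ### Coordinate forms on `ℝⁿ` -/

/-- The coordinate space `ℝⁿ`. -/
abbrev Coord (n : ℕ) : Type := EuclideanSpace ℝ (Fin n)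

/-- The exterior algebra `Λ((ℝⁿ)*)`. -/
abbrev CoordAlg (n : ℕ) : Type := ExteriorAlgebra ℝ (Module.Dual ℝ (Coord n))

/-- The standard basis `∂₁, …, ∂ₙ` of `ℝⁿ`. -/
def frame (n : ℕ) : Module.Basis (Fin n) ℝ (Coord n) :=
  (EuclideanSpace.basisFun (Fin n) ℝ).toBasis

/-- The dual basis `dx¹, …, dxⁿ` of `(ℝⁿ)*`. -/
def coframe (n : ℕ) : Module.Basis (Fin n) ℝ (Module.Dual ℝ (Coord n)) :=
  (frame n).dualBasis

/-- The basis `dx^S = dx^{s₁} ∧ ⋯ ∧ dx^{sₖ}` of `Λ((ℝⁿ)*)`, for `S = {s₁ < ⋯ < sₖ}`. -/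
def formBasis (n : ℕ) : Module.Basis (Finset (Fin n)) ℝ (CoordAlg n) :=
  (coframe n).ExteriorAlgebra

/-- The partial derivative `∂ᵢ f` of a real function on `ℝⁿ`. -/
def pderiv {n : ℕ} (i : Fin n) (f : Coord n → ℝ) (u : Coord n) : ℝ :=
  fderiv ℝ f u (frame n i)

/-- The partial derivative `∂ᵢ θ = ∑_S (∂ᵢ θ_S) dx^S` of a form `θ = ∑_S θ_S dx^S` on `ℝⁿ`. -/
def formPDeriv {n : ℕ} (i : Fin n) (θ : Coord n → CoordAlg n) (u : Coord n) : CoordAlg n :=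
  ∑ S : Finset (Fin n), pderiv i (fun v => (formBasis n).repr (θ v) S) u • formBasis n S

/-- The interior product `ι_{∂ᵢ}` on `Λ((ℝⁿ)*)`. -/
def intProd {n : ℕ} (i : Fin n) : CoordAlg n →ₗ[ℝ] CoordAlg n :=
  CliffordAlgebra.contractLeft (Module.Dual.eval ℝ (Coord n) (frame n i))

/-- The Christoffel symbol
`Γˡⱼₘ = ½ ∑ᵣ gˡʳ (∂ⱼ gᵣₘ + ∂ₘ gᵣⱼ - ∂ᵣ gⱼₘ)` of a matrix-valued function `g` on `ℝⁿ`. -/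
def christoffel {n : ℕ} (g : Coord n → Matrix (Fin n) (Fin n) ℝ) (l j m : Fin n)
    (u : Coord n) : ℝ :=
  (1 / 2) * ∑ r, (g u)⁻¹ l r *
    (pderiv j (fun v => g v r m) u + pderiv m (fun v => g v r j) u
      - pderiv r (fun v => g v j m) u)

/-- The Levi-Civita covariant derivative of forms along `∂ⱼ`, in coordinates:
`∇ⱼ θ = ∂ⱼ θ - ∑ Γˡⱼₘ dxᵐ ∧ ι_{∂ₗ} θ`. It is the derivation of the exterior algebra with
`∇ⱼ f = ∂ⱼ f` on functions and `∇ⱼ dxˡ = - ∑ Γˡⱼₘ dxᵐ`. -/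
def coordNabla {n : ℕ} (g : Coord n → Matrix (Fin n) (Fin n) ℝ) (j : Fin n)
    (θ : Coord n → CoordAlg n) (u : Coord n) : CoordAlg n :=
  formPDeriv j θ u - ∑ l, ∑ m, christoffel g l j m u •
    (ExteriorAlgebra.ι ℝ (coframe n m) * intProd l (θ u))

/-- The divergence (codifferential) in coordinates: the metric contraction
`∑ gⁱʲ ι_{∂ᵢ} ∇ⱼ θ` of the Levi-Civita covariant derivative. -/
def coordDiv {n : ℕ} (g : Coord n → Matrix (Fin n) (Fin n) ℝ)
    (θ : Coord n → CoordAlg n) (u : Coord n) : CoordAlg n :=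
  ∑ i, ∑ j, (g u)⁻¹ i j • intProd i (coordNabla g j θ u)

/-! ### The exterior algebra of a manifold -/

variable (n : ℕ) (M : Type*) [TopologicalSpace M] [ChartedSpace (EuclideanSpace ℝ (Fin n)) M]

/-- The cotangent space `T*ₓM`. -/
abbrev Cotangent (x : M) : Type := Module.Dual ℝ (TangentSpace (𝓡 n) x)

/-- Not necessarily smooth sections of the bundle `Λ T*M`, an algebra under the pointwise
wedge product. -/
abbrev RoughForm : Type _ := ∀ x : M, ExteriorAlgebra ℝ (Cotangent n M x)

variable {n M}

/-- The coordinate expression of a form in a chart `φ`: its pullback under `φ⁻¹`. -/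
def localForm (φ : OpenPartialHomeomorph M (EuclideanSpace ℝ (Fin n))) (θ : RoughForm n M)
    (u : Coord n) : CoordAlg n :=
  ExteriorAlgebra.map
    (Module.Dual.transpose (R := ℝ) (M := Coord n) (M' := TangentSpace (𝓡 n) (φ.symm u))
      (mfderiv (𝓡 n) (𝓡 n) φ.symm u).toLinearMap)
    (θ (φ.symm u))

/-- A form is smooth if its coefficients in every smooth chart are smooth. -/
def IsSmoothForm (θ : RoughForm n M) : Prop :=
  ∀ φ ∈ IsManifold.maximalAtlas (𝓡 n) ∞ M, ∀ S : Finset (Fin n),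
    ContDiffOn ℝ ∞ (fun u => (formBasis n).repr (localForm φ θ u) S) φ.target

/-- The coefficients of a product are bilinear in the coefficients of the factors. -/
theorem repr_mul (a b : CoordAlg n) (S : Finset (Fin n)) :
    (formBasis n).repr (a * b) S = ∑ A : Finset (Fin n), ∑ B : Finset (Fin n),
      (formBasis n).repr a A * (formBasis n).repr b B *
        (formBasis n).repr (formBasis n A * formBasis n B) S := by
  have h : a * b = ∑ A : Finset (Fin n), ∑ B : Finset (Fin n),
      ((formBasis n).repr a A * (formBasis n).repr b B) • (formBasis n A * formBasis n B) := by
    rw [← (formBasis n).sum_repr a, ← (formBasis n).sum_repr b, Finset.sum_mul_sum]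
    simp only [smul_mul_smul_comm, (formBasis n).sum_repr]
  rw [h]
  simp only [map_sum, Finsupp.finsetSum_apply, map_smul, Finsupp.smul_apply, smul_eq_mul]

variable (n M) in
/-- The exterior algebra `Ω(M)` of smooth differential forms (of mixed degree). -/
def Forms : Subalgebra ℝ (RoughForm n M) where
  carrier := {θ | IsSmoothForm θ}
  mul_mem' := by
    intro a b ha hb φ hφ S
    have : (fun u => (formBasis n).repr (localForm φ (a * b) u) S) =
        fun u => ∑ A : Finset (Fin n), ∑ B : Finset (Fin n),
          (formBasis n).repr (localForm φ a u) A * (formBasis n).repr (localForm φ b u) B *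
            (formBasis n).repr (formBasis n A * formBasis n B) S := by
      funext u
      rw [← repr_mul]
      simp [localForm]
    rw [this]
    refine ContDiffOn.sum fun A _ => ContDiffOn.sum fun B _ => ?_
    exact ((ha φ hφ A).mul (hb φ hφ B)).mul contDiffOn_const
  add_mem' := by
    intro a b ha hb φ hφ S
    simpa [localForm] using (ha φ hφ S).add (hb φ hφ S)
  algebraMap_mem' := by
    intro r φ _ S
    simpa [localForm] using contDiffOn_const

variable (n M) in
/-- The space `Ωᵏ(M)` of forms that are homogeneous of degree `k`. -/
def formsOfDegree (k : ℕ) : Submodule ℝ (Forms n M) where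
  carrier := {θ | ∀ x, (θ : RoughForm n M) x ∈ ⋀[ℝ]^k (Cotangent n M x)}
  add_mem' ha hb x := Submodule.add_mem _ (ha x) (hb x)
  zero_mem' _ := Submodule.zero_mem _
  smul_mem' c _ ha x := Submodule.smul_mem _ c (ha x)

/-- The differential of a function at a point, as a covector. -/
def dAt (a : C^∞⟮𝓡 n, M; ℝ⟯) (x : M) : Cotangent n M x :=
  (mfderiv (𝓡 n) 𝓘(ℝ, ℝ) a x).toLinearMap

/-- A smooth function as a differential form of degree `0`. -/
def ofFun (a : C^∞⟮𝓡 n, M; ℝ⟯) : Forms n M :=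
  ⟨fun x => algebraMap ℝ _ (a x), by
    intro φ hφ S
    have h : ContDiffOn ℝ ∞ (fun u => a (φ.symm u)) φ.target :=
      contMDiffOn_iff_contDiffOn.mp
        (a.contMDiff.comp_contMDiffOn (contMDiffOn_symm_of_mem_maximalAtlas hφ))
    have e : (fun u => (formBasis n).repr
        (localForm φ (fun x => algebraMap ℝ _ (a x)) u) S) =
        fun u => a (φ.symm u) * (formBasis n).repr 1 S := by
      funext u
      simp [localForm, Algebra.algebraMap_eq_smul_one]
    rw [e]
    exact h.mul contDiffOn_const⟩

/-- The exterior differential `da ∈ Ω¹(M)` of a smooth function. -/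
def dFun (a : C^∞⟮𝓡 n, M; ℝ⟯) : Forms n M :=
  ⟨fun x => ExteriorAlgebra.ι ℝ (dAt a x), by
    intro φ hφ S
    have h : ContDiffOn ℝ ∞ (fun u => a (φ.symm u)) φ.target :=
      contMDiffOn_iff_contDiffOn.mp
        (a.contMDiff.comp_contMDiffOn (contMDiffOn_symm_of_mem_maximalAtlas hφ))
    have h' : ContDiffOn ℝ ∞ (fderiv ℝ (fun u => a (φ.symm u))) φ.target :=
      h.fderiv_of_isOpen φ.open_target (by simp)
    let L : (Coord n →L[ℝ] ℝ) →ₗ[ℝ] ℝ :=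
      (Finsupp.lapply S ∘ₗ (formBasis n).repr.toLinearMap ∘ₗ ExteriorAlgebra.ι ℝ) ∘ₗ
        ContinuousLinearMap.coeLM ℝ
    refine ((LinearMap.toContinuousLinearMap L).contDiff.comp_contDiffOn h').congr ?_
    intro u hu
    have h1 : MDifferentiableAt (𝓡 n) 𝓘(ℝ, ℝ) a (φ.symm u) :=
      a.contMDiff.mdifferentiable (by simp) _
    have h2 : MDifferentiableAt (𝓡 n) (𝓡 n) φ.symm u :=
      (contMDiffAt_symm_of_mem_maximalAtlas hφ hu).mdifferentiableAt (by simp)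
    have h3 : fderiv ℝ (fun u => a (φ.symm u)) u =
        (mfderiv (𝓡 n) 𝓘(ℝ, ℝ) a (φ.symm u)).comp (mfderiv (𝓡 n) (𝓡 n) φ.symm u) := by
      rw [← mfderiv_eq_fderiv]
      exact mfderiv_comp u h1 h2
    show (formBasis n).repr (localForm φ _ u) S = (formBasis n).repr (ExteriorAlgebra.ι ℝ
      (fderiv ℝ (fun u => a (φ.symm u)) u).toLinearMap) S
    rw [h3, localForm, ExteriorAlgebra.map_apply_ι]
    rfl⟩

/-! ### Batalin-Vilkovisky structures on `Ω(M)` -/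

/-- `δ` makes the graded-commutative algebra `Ω(M)` a BV algebra: it lowers degree by one, squares
to zero and obeys the 7-term identity. The sign `(-1)^((p+1)q)` is `(-1)^((p-1)q)`. -/
structure IsBV (δ : Forms n M →ₗ[ℝ] Forms n M) : Prop where
  degree_zero : ∀ θ ∈ formsOfDegree n M 0, δ θ = 0
  degree_succ : ∀ k, ∀ θ ∈ formsOfDegree n M (k + 1), δ θ ∈ formsOfDegree n M k
  sq_zero : ∀ θ, δ (δ θ) = 0
  seven_term : ∀ p q, ∀ θ ∈ formsOfDegree n M p, ∀ η ∈ formsOfDegree n M q, ∀ ζ : Forms n M,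
    δ (θ * η * ζ) =
      δ (θ * η) * ζ + (-1) ^ p * (θ * δ (η * ζ)) + (-1) ^ ((p + 1) * q) * (η * δ (θ * ζ))
        - δ θ * η * ζ - (-1) ^ p * (θ * δ η * ζ) - (-1) ^ (p + q) * (θ * η * δ ζ)

/-- The symmetry condition `δ(a db) - a δ(db) = δ(b da) - b δ(da)`. -/
def IsSymmetricOp (δ : Forms n M →ₗ[ℝ] Forms n M) : Prop :=
  ∀ a b : C^∞⟮𝓡 n, M; ℝ⟯,
    δ (ofFun a * dFun b) - ofFun a * δ (dFun b) = δ (ofFun b * dFun a) - ofFun b * δ (dFun a)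

/-- The associated bilinear form `(θ, da) = δ(a θ) - a δθ` on `1`-forms, at the point `x`.
The right-hand side is a form of degree `0` if `δ` lowers degree by one and `θ ∈ Ω¹(M)`;
`algebraMapInv` reads it as a number. -/
def pairing (δ : Forms n M →ₗ[ℝ] Forms n M) (θ : Forms n M) (a : C^∞⟮𝓡 n, M; ℝ⟯) (x : M) : ℝ :=
  ExteriorAlgebra.algebraMapInv
    (((δ (ofFun a * θ) - ofFun a * δ θ : Forms n M) : RoughForm n M) x)

/-- The associated bilinear form is nondegenerate at every point. -/
def PairingNondegenerate (δ : Forms n M →ₗ[ℝ] Forms n M) : Prop :=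
  ∀ x : M, ∀ θ ∈ formsOfDegree n M 1,
    (∀ a : C^∞⟮𝓡 n, M; ℝ⟯, pairing δ θ a x = 0) → (θ : RoughForm n M) x = 0

/-- The associated bilinear form is positive definite at every point. -/
def PairingPosDef (δ : Forms n M →ₗ[ℝ] Forms n M) : Prop :=
  ∀ (x : M) (a : C^∞⟮𝓡 n, M; ℝ⟯), dAt a x ≠ 0 → 0 < pairing δ (dFun a) a x

/-! ### Metrics -/

variable (n M) in
/-- A metric on `M` (of any signature): a smooth field of nondegenerate symmetric bilinear forms
on the tangent spaces. Smoothness: the components `gᵢⱼ = g(∂ᵢ, ∂ⱼ)` in every smooth chart are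
smooth. -/
@[ext]
structure Metric where
  val : ∀ x : M, LinearMap.BilinForm ℝ (TangentSpace (𝓡 n) x)
  symm : ∀ x v w, val x v w = val x w v
  nondegenerate : ∀ x, (val x).Nondegenerate
  smooth : ∀ φ ∈ IsManifold.maximalAtlas (𝓡 n) ∞ M, ∀ i j : Fin n,
    ContDiffOn ℝ ∞ (fun u : Coord n => val (φ.symm u)
      (mfderiv (𝓡 n) (𝓡 n) φ.symm u (frame n i))
      (mfderiv (𝓡 n) (𝓡 n) φ.symm u (frame n j))) φ.target

namespace Metric

/-- The metric is positive definite. -/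
def PosDef (g : Metric n M) : Prop := ∀ x v, v ≠ 0 → 0 < g.val x v v

/-- The component matrix `gᵢⱼ` in a chart. -/
def components (g : Metric n M) (φ : OpenPartialHomeomorph M (EuclideanSpace ℝ (Fin n)))
    (u : Coord n) : Matrix (Fin n) (Fin n) ℝ :=
  Matrix.of fun i j => g.val (φ.symm u)
    (mfderiv (𝓡 n) (𝓡 n) φ.symm u (frame n i))
    (mfderiv (𝓡 n) (𝓡 n) φ.symm u (frame n j))

instance (x : M) : FiniteDimensional ℝ (TangentSpace (𝓡 n) x) :=
  inferInstanceAs (FiniteDimensional ℝ (EuclideanSpace ℝ (Fin n)))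

/-- The inverse metric on covectors: `(α, β) = g(α♯, β♯)`, where `g(α♯, ·) = α`. -/
def inv (g : Metric n M) (x : M) (α β : Cotangent n M x) : ℝ :=
  g.val x (((g.val x).toDual (g.nondegenerate x)).symm α)
    (((g.val x).toDual (g.nondegenerate x)).symm β)

end Metric

/-- The bilinear form associated to `δ` is the inverse of the metric `g`:
`δ(a θ) - a δθ = (θ, da)` for all `1`-forms `θ` and functions `a`. -/
def IsInverseMetricOf (δ : Forms n M →ₗ[ℝ] Forms n M) (g : Metric n M) : Prop :=
  ∀ θ ∈ formsOfDegree n M 1, ∀ (a : C^∞⟮𝓡 n, M; ℝ⟯) (x : M),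
    pairing δ θ a x = g.inv x (ExteriorAlgebra.ιInv ((θ : RoughForm n M) x)) (dAt a x)

/-- `δ` is the codifferential (divergence) of `g`: in every smooth chart it is the metric
contraction of the Levi-Civita covariant derivative. On `1`-forms this is
`δθ = div(θ♯)`. With this sign `δ` is minus the formal adjoint of `d`. -/
def IsCodifferential (g : Metric n M) (δ : Forms n M →ₗ[ℝ] Forms n M) : Prop :=
  ∀ φ ∈ IsManifold.maximalAtlas (𝓡 n) ∞ M, ∀ (θ : Forms n M), ∀ u ∈ φ.target,
    localForm φ (δ θ : RoughForm n M) u =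
      coordDiv (g.components φ) (localForm φ (θ : RoughForm n M)) u

end BVGeom
end

/-! From metrics to BV structures. In a chart, `coordDiv` is a sum of operators `gⁱʲ ι_{∂ᵢ} ∇ⱼ`,
where `ι_{∂ᵢ}` is an odd and `∇ⱼ` an even derivation of the exterior algebra. The composite of two
such derivations obeys the 7-term identity (`seven_term_of_derivation`), and the coefficients `gⁱʲ`
only multiply it, so the identity holds term by term (`coordDiv_seven_term`).

For `δ² = 0`, indices are raised by `dxⁱ ↦ ∑ gⁱʲ dxʲ`. Since the inverse metric is parallel, `∇ⱼ`
becomes a covariant derivative of polyvector fields. Since the Christoffel symbols are symmetric,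
only their contraction survives, and the divergence becomes `∑ ιⱼ (∂ⱼ + wⱼ)` with `wⱼ = ∑ Γˡₗⱼ`
(`coMap_inv_coordDiv`). The form `w` is closed (it is `d log √|det g|`), so the operators `∂ⱼ + wⱼ`
commute. The contractions anticommute, so the square vanishes (`coordDiv_coordDiv`).

The local operators agree on overlaps by the transformation law of the Christoffel symbols
(`connMatrix_transform`, `coordDiv_pullback`) and glue to `codiff`. Replacing `θ` by `aθ` adds the
term `∑ gⁱʲ ∂ⱼa ι_{∂ᵢ} θ`, so the associated bilinear form is the inverse metric
(`IsCodifferential.isInverseMetricOf`). Its symmetry and nondegeneracy give those of `δ`.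

From BV structures to metrics. The 7-term identity with two functions says that the associated form
is linear over functions in the `1`-form (`pairing_ofFun_mul`). Cutoffs and local coframes then show
that it depends only on the value of the `1`-form at the point (`pairing_congr`), and symmetry
carries this over to the other argument. Every covector is the differential of a global function, so
there is a symmetric nondegenerate form on each cotangent space (`exists_covector_form`). Its
inverse is the metric, smooth because its matrix is inverse to a matrix of smooth functions
(`exists_inverse_metric`). -/

noncomputable section

namespace BVGeom

/-! ### The exterior algebra as a graded-commutative algebra -/

section Algebra

open CliffordAlgebra (involute contractLeft)

variable {R V W : Type*} [CommRing R] [AddCommGroup V] [Module R V] [AddCommGroup W] [Module R W]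

theorem involute_of_mem {p : ℕ} {a : ExteriorAlgebra R V} (ha : a ∈ ⋀[R]^p V) :
    involute a = (-1) ^ p * a := by
  induction ha using Submodule.pow_induction_on_left' with
  | algebraMap r => simp
  | add x y i hx hy ihx ihy => rw [map_add, ihx, ihy, mul_add]
  | mem_mul m hm i x hx ih =>
    obtain ⟨v, rfl⟩ := hm
    rw [map_mul, ih]
    erw [CliffordAlgebra.involute_ι]
    rw [pow_succ]
    have : Commute ((-1 : ExteriorAlgebra R V) ^ i) (ExteriorAlgebra.ι R v) :=
      (Commute.neg_one_left _).pow_left _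
    rw [neg_mul, ← mul_assoc, ← this.eq]
    simp [ExteriorAlgebra.ι, mul_assoc]

/-- The sign for moving a `1`-form past any element, homogeneous or not. Graded commutativity and
the derivation property of `derivExt` both reduce to it. -/
theorem ι_mul_involute (v : V) (a : ExteriorAlgebra R V) :
    ExteriorAlgebra.ι R v * involute a = a * ExteriorAlgebra.ι R v := by
  induction a using ExteriorAlgebra.induction with
  | algebraMap r => simpa using (Algebra.commutes r _).symm
  | ι w =>
    have := ExteriorAlgebra.ι_add_mul_swap (R := R) v w
    erw [CliffordAlgebra.involute_ι]
    rw [mul_neg]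
    exact (eq_neg_of_add_eq_zero_right this).symm
  | mul a b ha hb => rw [map_mul, ← mul_assoc, ha, mul_assoc, hb, mul_assoc]
  | add a b ha hb => rw [map_add, mul_add, ha, hb, add_mul]

/-- The interior product is an odd derivation: the Leibniz rule on generators propagates to products
because the involution is multiplicative. -/
theorem contractLeft_mul (d : Module.Dual R V) (a b : ExteriorAlgebra R V) :
    contractLeft d (a * b) = contractLeft d a * b + involute a * contractLeft d b := by
  induction a using ExteriorAlgebra.induction generalizing b with
  | algebraMap r =>
    rw [CliffordAlgebra.contractLeft_algebraMap_mul, CliffordAlgebra.contractLeft_algebraMap]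
    simp
  | ι w =>
    have h := CliffordAlgebra.contractLeft_ι_mul (Q := (0 : QuadraticForm R V)) d w b
    have h2 := CliffordAlgebra.contractLeft_ι (Q := (0 : QuadraticForm R V)) d w
    have h3 := CliffordAlgebra.involute_ι (Q := (0 : QuadraticForm R V)) w
    rw [ExteriorAlgebra.ι, h, h2, h3, Algebra.smul_def, neg_mul, sub_eq_add_neg]
  | mul a c ha hc =>
    rw [mul_assoc, ha, hc, ha c, map_mul]
    simp only [mul_add, add_mul, mul_assoc, add_assoc]
  | add a c ha hc => simp only [add_mul, map_add, ha, hc]; abel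

theorem contractLeft_mem {p : ℕ} (d : Module.Dual R V) {a : ExteriorAlgebra R V}
    (ha : a ∈ ⋀[R]^(p + 1) V) : contractLeft d a ∈ ⋀[R]^p V := by
  -- With truncated subtraction, `q = 0` must carry the stronger claim that the contraction
  -- vanishes: for `i = 0` the term `ι v * contractLeft d x` has to drop out of degree `0`.
  have key : ∀ (q : ℕ) (a : ExteriorAlgebra R V), a ∈ ⋀[R]^q V →
      contractLeft d a ∈ ⋀[R]^(q - 1) V ∧ (q = 0 → contractLeft d a = 0) := by
    intro q a ha
    induction ha using Submodule.pow_induction_on_left' with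
    | algebraMap r => simp [CliffordAlgebra.contractLeft_algebraMap]
    | add x y i hx hy ihx ihy =>
      rw [map_add]
      exact ⟨Submodule.add_mem _ ihx.1 ihy.1, fun h => by rw [ihx.2 h, ihy.2 h, add_zero]⟩
    | mem_mul m hm i x hx ih =>
      obtain ⟨v, rfl⟩ := hm
      refine ⟨?_, fun h => by simp at h⟩
      have h := CliffordAlgebra.contractLeft_ι_mul (Q := (0 : QuadraticForm R V)) d v x
      rw [ExteriorAlgebra.ι, h]
      refine Submodule.sub_mem _ (Submodule.smul_mem _ _ hx) ?_
      rcases Nat.eq_zero_or_pos i with rfl | hi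
      · rw [ih.2 rfl]; simp
      · obtain ⟨k, rfl⟩ := Nat.exists_eq_succ_of_ne_zero hi.ne'
        have : (ExteriorAlgebra.ι R v) * contractLeft d x ∈ ⋀[R]^(1 + k) V :=
          SetLike.mul_mem_graded (A := fun i : ℕ => ⋀[R]^i V) (by simp) ih.1
        rw [add_comm] at this
        exact this
  exact (key _ a ha).1

theorem contractLeft_of_mem_zero (d : Module.Dual R V) {a : ExteriorAlgebra R V}
    (ha : a ∈ ⋀[R]^0 V) : contractLeft d a = 0 := by
  change a ∈ LinearMap.range (ExteriorAlgebra.ι R : V →ₗ[R] ExteriorAlgebra R V) ^ 0 at ha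
  rw [pow_zero] at ha
  obtain ⟨r, rfl⟩ := Submodule.mem_one.1 ha
  exact CliffordAlgebra.contractLeft_algebraMap (Q := (0 : QuadraticForm R V)) d r

theorem mul_comm_of_mem {p q : ℕ} {a b : ExteriorAlgebra R V} (ha : a ∈ ⋀[R]^p V)
    (hb : b ∈ ⋀[R]^q V) : a * b = (-1) ^ (p * q) * (b * a) := by
  induction ha using Submodule.pow_induction_on_left' with
  | algebraMap r => simpa using Algebra.commutes r b
  | add x y i hx hy ihx ihy => rw [add_mul, ihx, ihy, mul_add, mul_add]
  | mem_mul m hm i x hx ih =>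
    obtain ⟨v, rfl⟩ := hm
    have h := ι_mul_involute v b
    rw [involute_of_mem hb] at h
    have hc : ∀ (k : ℕ) (y : ExteriorAlgebra R V), Commute ((-1 : ExteriorAlgebra R V) ^ k) y :=
      fun k y => (Commute.neg_one_left _).pow_left _
    have h' : ExteriorAlgebra.ι R v * b = (-1) ^ q * (b * ExteriorAlgebra.ι R v) := by
      rw [← h, ← mul_assoc, ← mul_assoc, (hc q _).eq, mul_assoc _ _ ((-1) ^ q), ← pow_add,
        Even.neg_one_pow ⟨q, rfl⟩, mul_one]
    rw [mul_assoc, ih, ← mul_assoc, ← (hc _ _).eq, mul_assoc, ← mul_assoc _ b x, h', Nat.succ_mul, pow_add]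
    simp only [mul_assoc]

theorem map_mem_exteriorPower (f : V →ₗ[R] W) {p : ℕ} {a : ExteriorAlgebra R V}
    (ha : a ∈ ⋀[R]^p V) : ExteriorAlgebra.map f a ∈ ⋀[R]^p W := by
  have h := Submodule.mem_map_of_mem (f := (ExteriorAlgebra.map f).toLinearMap) ha
  rw [Submodule.map_pow] at h
  have hle : (LinearMap.range (ExteriorAlgebra.ι R)).map (ExteriorAlgebra.map f).toLinearMap ≤
      LinearMap.range (ExteriorAlgebra.ι R : W →ₗ[R] ExteriorAlgebra R W) := by
    rintro _ ⟨_, ⟨v, rfl⟩, rfl⟩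
    exact ⟨f v, by simp⟩
  exact pow_le_pow_left' hle p h

theorem contractLeft_map (f : V →ₗ[R] W) (d : Module.Dual R W) (a : ExteriorAlgebra R V) :
    contractLeft d (ExteriorAlgebra.map f a) = ExteriorAlgebra.map f (contractLeft (d ∘ₗ f) a) := by
  induction a using ExteriorAlgebra.induction with
  | algebraMap r =>
    rw [AlgHom.commutes, CliffordAlgebra.contractLeft_algebraMap,
      CliffordAlgebra.contractLeft_algebraMap, map_zero]
  | ι w =>
    have h1 := CliffordAlgebra.contractLeft_ι (Q := (0 : QuadraticForm R W)) d (f w)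
    have h2 := CliffordAlgebra.contractLeft_ι (Q := (0 : QuadraticForm R V)) (d ∘ₗ f) w
    rw [ExteriorAlgebra.map_apply_ι, ExteriorAlgebra.ι, h1, ExteriorAlgebra.ι, h2,
      AlgHom.commutes, LinearMap.comp_apply]
  | mul a b ha hb =>
    have hi : ∀ x : ExteriorAlgebra R V, involute (ExteriorAlgebra.map f x) =
        ExteriorAlgebra.map f (involute x) := fun x => by
      have : (involute.comp (ExteriorAlgebra.map f)) =
          (ExteriorAlgebra.map f).comp (involute (Q := (0 : QuadraticForm R V))) := by
        apply ExteriorAlgebra.hom_ext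
        ext v
        have h3 := CliffordAlgebra.involute_ι (Q := (0 : QuadraticForm R V)) v
        have h4 := CliffordAlgebra.involute_ι (Q := (0 : QuadraticForm R W)) (f v)
        simp only [LinearMap.comp_apply, AlgHom.toLinearMap_apply, AlgHom.comp_apply,
          ExteriorAlgebra.map_apply_ι]
        rw [ExteriorAlgebra.ι, h4, ExteriorAlgebra.ι, h3, map_neg]
        exact congrArg _ (ExteriorAlgebra.map_apply_ι f v).symm
      exact DFunLike.congr_fun this x
    rw [map_mul, contractLeft_mul, ha, hb, contractLeft_mul, map_add, map_mul, map_mul, hi]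
  | add a b ha hb => simp only [map_add, ha, hb]

theorem algebraMapInv_map (f : V →ₗ[R] W) (a : ExteriorAlgebra R V) :
    ExteriorAlgebra.algebraMapInv (ExteriorAlgebra.map f a) = ExteriorAlgebra.algebraMapInv a := by
  have : (ExteriorAlgebra.algebraMapInv (R := R) (M := W)).comp (ExteriorAlgebra.map f) =
      ExteriorAlgebra.algebraMapInv := by
    apply ExteriorAlgebra.hom_ext
    ext v
    simp [ExteriorAlgebra.algebraMapInv]
  exact DFunLike.congr_fun this a

/-- The composite of an odd derivation `ι_d` with an even derivation obeys the 7-term identity.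
Here `a'`, `b'`, `c'` are the values of the even derivation on `a`, `b`, `c`. -/
theorem seven_term_of_derivation (d : Module.Dual R V) {p q : ℕ} {a a' b b' : ExteriorAlgebra R V}
    (ha : a ∈ ⋀[R]^p V) (ha' : a' ∈ ⋀[R]^p V) (hb : b ∈ ⋀[R]^q V) (hb' : b' ∈ ⋀[R]^q V)
    (c c' : ExteriorAlgebra R V) :
    contractLeft d (a' * b * c + a * b' * c + a * b * c') =
      contractLeft d (a' * b + a * b') * c + (-1) ^ p * (a * contractLeft d (b' * c + b * c'))
        + (-1) ^ ((p + 1) * q) * (b * contractLeft d (a' * c + a * c'))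
        - contractLeft d a' * b * c - (-1) ^ p * (a * contractLeft d b' * c)
        - (-1) ^ (p + q) * (a * b * contractLeft d c') := by
  -- The contraction of `x` has degree `p - 1`, and `(p + 1) q` has the parity of `(p - 1) q`. For
  -- `p = 0` both sides vanish.
  have hc : ∀ {x : ExteriorAlgebra R V}, x ∈ ⋀[R]^p V →
      (-1) ^ ((p + 1) * q) * (b * contractLeft d x) = contractLeft d x * b := by
    intro x hx
    rcases p with _ | p
    · rw [contractLeft_of_mem_zero d hx]; simp
    · rw [mul_comm_of_mem (contractLeft_mem d hx) hb]
      congr 1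
      rw [show (p + 1 + 1) * q = p * q + 2 * q by ring, pow_add, pow_mul _ 2]
      simp
  have hc2 : ∀ {x : ExteriorAlgebra R V}, x ∈ ⋀[R]^p V →
      (-1) ^ ((p + 1) * q) * (b * x) = (-1) ^ q * (x * b) := by
    intro x hx
    rw [mul_comm_of_mem hx hb, ← mul_assoc ((-1) ^ q), ← pow_add]
    congr 2
    ring
  have h1 := hc ha
  have h2 := hc ha'
  have h3 := hc2 ha
  have h4 := hc2 ha'
  -- The only term in which `b` stands to the left of `a`; here `b` is moved back into second place,
  -- after which no graded commutation is needed.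
  have e1 : (-1) ^ ((p + 1) * q) * (b * contractLeft d (a' * c + a * c')) =
      contractLeft d a' * b * c + (-1) ^ p * ((-1) ^ q * (a' * b * contractLeft d c)) +
      (contractLeft d a * b * c' + (-1) ^ p * ((-1) ^ q * (a * b * contractLeft d c'))) := by
    have hn : ∀ (k : ℕ) (y : ExteriorAlgebra R V), Commute ((-1 : ExteriorAlgebra R V) ^ k) y :=
      fun k y => (Commute.neg_one_left _).pow_left _
    have aux : ∀ x ∈ ⋀[R]^p V, ∀ y z : ExteriorAlgebra R V,
        (-1) ^ ((p + 1) * q) * (b * (contractLeft d x * y + (-1) ^ p * x * z)) =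
        contractLeft d x * b * y + (-1) ^ p * ((-1) ^ q * (x * b * z)) := by
      intro x hx y z
      rw [← hc hx, mul_add, mul_add]
      congr 1
      · simp only [mul_assoc]
      · rw [← mul_assoc ((-1) ^ q), ← hc2 hx]
        rw [← mul_assoc b, ← mul_assoc b, ← (hn p b).eq]
        simp only [mul_assoc]
        rw [← mul_assoc, ← mul_assoc ((-1) ^ p), (hn _ _).eq]
    rw [map_add, contractLeft_mul, contractLeft_mul, involute_of_mem ha, involute_of_mem ha',
      mul_add, mul_add, aux _ ha, aux _ ha']
  rw [e1]
  simp only [map_add, contractLeft_mul, map_mul, involute_of_mem ha, involute_of_mem ha',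
    involute_of_mem hb, involute_of_mem hb']
  -- Once the parities fix all signs, an identity in a noncommutative ring remains.
  rcases Nat.even_or_odd p with hp | hp <;> rcases Nat.even_or_odd q with hq | hq <;>
    simp only [hp.neg_one_pow, hq.neg_one_pow, pow_add] <;> noncomm_ring

end Algebra

/-! ### Calculus of coordinate forms -/

/-- The sup norm of the coefficients in the basis `dx^S`. -/
@[reducible]
def coordAlgNormedAddCommGroup (n : ℕ) : NormedAddCommGroup (CoordAlg n) :=
  NormedAddCommGroup.induced (CoordAlg n) (Finset (Fin n) → ℝ) (formBasis n).equivFun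
    (formBasis n).equivFun.injective

attribute [local instance] coordAlgNormedAddCommGroup

@[reducible]
def coordAlgNormedSpace (n : ℕ) : NormedSpace ℝ (CoordAlg n) :=
  NormedSpace.induced ℝ (CoordAlg n) (Finset (Fin n) → ℝ) (formBasis n).equivFun

attribute [local instance] coordAlgNormedSpace

instance (n : ℕ) : FiniteDimensional ℝ (CoordAlg n) := (formBasis n).finiteDimensional_of_finite

section Calculus

variable {n : ℕ} {F : Type*} [NormedAddCommGroup F] [NormedSpace ℝ F]

/-- The coefficients in the basis `dx^S`, as a continuous linear equivalence. -/
def coeffEquiv (n : ℕ) : CoordAlg n ≃L[ℝ] (Finset (Fin n) → ℝ) :=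
  (formBasis n).equivFun.toContinuousLinearEquiv

/-- The norm on the exterior algebra is auxiliary. This lemma links Fréchet calculus to the
coefficients in which `IsSmoothForm` and `formPDeriv` are phrased. -/
theorem contDiffAt_form_iff {k : WithTop ℕ∞} {θ : F → CoordAlg n} {u : F} :
    ContDiffAt ℝ k θ u ↔ ∀ S, ContDiffAt ℝ k (fun v => (formBasis n).repr (θ v) S) u := by
  rw [← (coeffEquiv n).comp_contDiffAt_iff, contDiffAt_pi]
  rfl

theorem contDiffOn_form_iff {k : WithTop ℕ∞} {θ : F → CoordAlg n} {s : Set F} :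
    ContDiffOn ℝ k θ s ↔ ∀ S, ContDiffOn ℝ k (fun v => (formBasis n).repr (θ v) S) s := by
  rw [← (coeffEquiv n).comp_contDiffOn_iff, contDiffOn_pi]
  rfl

theorem formPDeriv_eq {θ : Coord n → CoordAlg n} {u : Coord n} (hθ : DifferentiableAt ℝ θ u)
    (i : Fin n) : formPDeriv i θ u = fderiv ℝ θ u (frame n i) := by
  rw [← (formBasis n).sum_repr (fderiv ℝ θ u (frame n i)), formPDeriv]
  refine Finset.sum_congr rfl fun S _ => ?_
  congr 1
  have h := ((ContinuousLinearMap.proj (R := ℝ) (φ := fun _ : Finset (Fin n) => ℝ) S).comp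
    (coeffEquiv n : CoordAlg n →L[ℝ] (Finset (Fin n) → ℝ))).hasFDerivAt.comp u hθ.hasFDerivAt
  have h' : HasFDerivAt (fun v => (formBasis n).repr (θ v) S) _ u := h
  rw [pderiv, h'.fderiv]
  rfl

theorem hasFDerivAt_linear (L : CoordAlg n →ₗ[ℝ] CoordAlg n) {θ : F → CoordAlg n}
    {θ' : F →L[ℝ] CoordAlg n} {u : F} (h : HasFDerivAt θ θ' u) :
    HasFDerivAt (fun v => L (θ v)) ((LinearMap.toContinuousLinearMap L).comp θ') u :=
  (LinearMap.toContinuousLinearMap L).hasFDerivAt.comp u h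

theorem differentiableAt_linear (L : CoordAlg n →ₗ[ℝ] CoordAlg n) {θ : F → CoordAlg n}
    {u : F} (h : DifferentiableAt ℝ θ u) : DifferentiableAt ℝ (fun v => L (θ v)) u :=
  (hasFDerivAt_linear L h.hasFDerivAt).differentiableAt

theorem fderiv_linear (L : CoordAlg n →ₗ[ℝ] CoordAlg n) {θ : F → CoordAlg n}
    {u : F} (h : DifferentiableAt ℝ θ u) (X : F) :
    fderiv ℝ (fun v => L (θ v)) u X = L (fderiv ℝ θ u X) := by
  rw [(hasFDerivAt_linear L h.hasFDerivAt).fderiv]; rfl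

theorem contDiffAt_linear {k : WithTop ℕ∞} (L : CoordAlg n →ₗ[ℝ] CoordAlg n) {θ : F → CoordAlg n}
    {u : F} (h : ContDiffAt ℝ k θ u) : ContDiffAt ℝ k (fun v => L (θ v)) u :=
  (LinearMap.toContinuousLinearMap L).contDiff.contDiffAt.comp u h

/-- The wedge product as a continuous bilinear map. -/
def wedgeL (n : ℕ) : CoordAlg n →L[ℝ] CoordAlg n →L[ℝ] CoordAlg n :=
  (LinearMap.mul ℝ (CoordAlg n)).toContinuousBilinearMap

theorem differentiableAt_wedge {θ η : F → CoordAlg n} {u : F} (hθ : DifferentiableAt ℝ θ u)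
    (hη : DifferentiableAt ℝ η u) : DifferentiableAt ℝ (fun v => θ v * η v) u :=
  ((wedgeL n).hasFDerivAt_of_bilinear hθ.hasFDerivAt hη.hasFDerivAt).differentiableAt

theorem fderiv_wedge {θ η : F → CoordAlg n} {u : F} (hθ : DifferentiableAt ℝ θ u)
    (hη : DifferentiableAt ℝ η u) (X : F) :
    fderiv ℝ (fun v => θ v * η v) u X = fderiv ℝ θ u X * η u + θ u * fderiv ℝ η u X := by
  have h := (wedgeL n).hasFDerivAt_of_bilinear hθ.hasFDerivAt hη.hasFDerivAt
  have h' : HasFDerivAt (fun v => θ v * η v) _ u := h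
  rw [h'.fderiv, add_comm]
  rfl

theorem contDiffAt_wedge {k : WithTop ℕ∞} {θ η : F → CoordAlg n} {u : F} (hθ : ContDiffAt ℝ k θ u)
    (hη : ContDiffAt ℝ k η u) : ContDiffAt ℝ k (fun v => θ v * η v) u :=
  (wedgeL n).isBoundedBilinearMap.contDiff.contDiffAt.comp u (hθ.prodMk hη)

/-- A subspace is the kernel of a linear map, so membership is an equation that can be
differentiated. This is how `∂ⱼ` preserves the degree of a form. Where `θ` is not differentiable,
`fderiv` is zero by default. -/
theorem fderiv_mem_submodule {θ : F → CoordAlg n} {u : F} (p : Submodule ℝ (CoordAlg n))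
    (h : ∀ᶠ v in nhds u, θ v ∈ p) (X : F) : fderiv ℝ θ u X ∈ p := by
  by_cases hθ : DifferentiableAt ℝ θ u
  swap
  · rw [fderiv_zero_of_not_differentiableAt hθ]; exact p.zero_mem
  obtain ⟨f, hf⟩ : ∃ f : CoordAlg n →ₗ[ℝ] CoordAlg n, LinearMap.ker f = p := by
    obtain ⟨q, hq⟩ := p.exists_isCompl
    exact ⟨q.subtype ∘ₗ q.projectionOnto p hq.symm, by
      rw [LinearMap.ker_comp_of_ker_eq_bot _ q.ker_subtype, Submodule.ker_projectionOnto]⟩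
  rw [← hf, LinearMap.mem_ker, ← fderiv_linear f hθ]
  have : (fun v => f (θ v)) =ᶠ[nhds u] fun _ => 0 := by
    filter_upwards [h] with v hv
    rwa [← LinearMap.mem_ker, hf]
  rw [this.fderiv_eq]
  simp

end Calculus

/-! ### Matrices acting on coordinate forms -/

section MatrixAction

variable {n : ℕ}

theorem coframe_apply_frame (i j : Fin n) : coframe n i (frame n j) = if j = i then 1 else 0 := by
  simp [coframe, Finsupp.single_apply]

theorem sum_apply_frame_smul_coframe (α : Module.Dual ℝ (Coord n)) :
    ∑ l, α (frame n l) • coframe n l = α := by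
  simp [coframe, Module.Basis.coe_dualBasis]

theorem intProd_ι (i : Fin n) (α : Module.Dual ℝ (Coord n)) :
    intProd i (ExteriorAlgebra.ι ℝ α) = algebraMap ℝ _ (α (frame n i)) :=
  CliffordAlgebra.contractLeft_ι (Q := (0 : QuadraticForm ℝ (Module.Dual ℝ (Coord n)))) _ α

theorem intProd_algebraMap (i : Fin n) (r : ℝ) :
    intProd i (algebraMap ℝ (CoordAlg n) r) = 0 :=
  CliffordAlgebra.contractLeft_algebraMap (Q := (0 : QuadraticForm ℝ (Module.Dual ℝ (Coord n)))) _ r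

theorem intProd_comm (i j : Fin n) (a : CoordAlg n) :
    intProd i (intProd j a) = -intProd j (intProd i a) :=
  CliffordAlgebra.contractLeft_comm (Q := (0 : QuadraticForm ℝ (Module.Dual ℝ (Coord n)))) _ _ a

theorem intProd_ι_mul (i : Fin n) (α : Module.Dual ℝ (Coord n)) (a : CoordAlg n) :
    intProd i (ExteriorAlgebra.ι ℝ α * a) =
      α (frame n i) • a - ExteriorAlgebra.ι ℝ α * intProd i a :=
  CliffordAlgebra.contractLeft_ι_mul (Q := (0 : QuadraticForm ℝ (Module.Dual ℝ (Coord n)))) _ α a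

/-- The endomorphism `dxˡ ↦ ∑ aˡₘ dxᵐ` of `(ℝⁿ)*`. -/
def coEnd (a : Matrix (Fin n) (Fin n) ℝ) : Module.Dual ℝ (Coord n) →ₗ[ℝ] Module.Dual ℝ (Coord n) :=
  (coframe n).constr ℝ fun l => ∑ m, a l m • coframe n m

theorem coEnd_coframe (a : Matrix (Fin n) (Fin n) ℝ) (l : Fin n) :
    coEnd a (coframe n l) = ∑ m, a l m • coframe n m := by
  simp [coEnd]

theorem coEnd_add (a b : Matrix (Fin n) (Fin n) ℝ) : coEnd (a + b) = coEnd a + coEnd b := by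
  refine (coframe n).ext fun l => ?_
  simp [coEnd_coframe, add_smul, Finset.sum_add_distrib]

theorem coEnd_smul (r : ℝ) (a : Matrix (Fin n) (Fin n) ℝ) : coEnd (r • a) = r • coEnd a := by
  refine (coframe n).ext fun l => ?_
  simp [coEnd_coframe, mul_smul, Finset.smul_sum]

theorem coEnd_one : coEnd (1 : Matrix (Fin n) (Fin n) ℝ) = LinearMap.id := by
  refine (coframe n).ext fun l => ?_
  simp [coEnd_coframe, Matrix.one_apply]

/-- The rows of the matrix are the images of the `dxˡ`, so products of matrices act in reversed
order, as pullbacks do. -/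
theorem coEnd_mul (a b : Matrix (Fin n) (Fin n) ℝ) : coEnd (a * b) = coEnd b ∘ₗ coEnd a := by
  refine (coframe n).ext fun l => ?_
  simp only [LinearMap.comp_apply, coEnd_coframe, map_sum, map_smul, Matrix.mul_apply,
    Finset.sum_smul, Finset.smul_sum, mul_smul]
  exact Finset.sum_comm

theorem coEnd_apply_frame (a : Matrix (Fin n) (Fin n) ℝ) (α : Module.Dual ℝ (Coord n))
    (i : Fin n) : coEnd a α (frame n i) = ∑ l, α (frame n l) * a l i := by
  conv_lhs => rw [← sum_apply_frame_smul_coframe α]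
  simp [coEnd_coframe, coframe_apply_frame]

/-- The action of `coEnd a` on the exterior algebra. -/
abbrev coMap (a : Matrix (Fin n) (Fin n) ℝ) : CoordAlg n →ₐ[ℝ] CoordAlg n :=
  ExteriorAlgebra.map (coEnd a)

theorem coMap_one (c : CoordAlg n) : coMap 1 c = c := by
  simp [coMap, coEnd_one]

theorem coMap_coMap (a b : Matrix (Fin n) (Fin n) ℝ) (c : CoordAlg n) :
    coMap b (coMap a c) = coMap (a * b) c := by
  rw [coMap, coMap, coMap, coEnd_mul, ← ExteriorAlgebra.map_comp_map]
  rfl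

theorem coMap_injective {a : Matrix (Fin n) (Fin n) ℝ} (ha : IsUnit a.det) :
    Function.Injective (coMap a) := by
  refine Function.LeftInverse.injective (g := coMap a⁻¹) fun c => ?_
  rw [coMap_coMap, Matrix.mul_nonsing_inv _ ha, coMap_one]

/-- Naturality of contraction: pulling back a form pushes the vector `∂ᵢ` forward. With `a = g⁻¹` it
absorbs the factor `gⁱʲ` of the divergence. -/
theorem intProd_coMap (a : Matrix (Fin n) (Fin n) ℝ) (i : Fin n) (c : CoordAlg n) :
    intProd i (coMap a c) = ∑ l, a l i • coMap a (intProd l c) := by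
  have h : (Module.Dual.eval ℝ (Coord n) (frame n i)) ∘ₗ coEnd a =
      ∑ l, a l i • Module.Dual.eval ℝ (Coord n) (frame n l) := by
    ext α
    simp [coEnd_apply_frame, mul_comm]
  rw [intProd, coMap, contractLeft_map, h]
  simp only [map_sum, map_smul, LinearMap.sum_apply, LinearMap.smul_apply]
  rfl

/-- The even derivation of the exterior algebra that extends an endomorphism of `(ℝⁿ)*`. -/
def derivExt (N : Module.Dual ℝ (Coord n) →ₗ[ℝ] Module.Dual ℝ (Coord n)) :
    CoordAlg n →ₗ[ℝ] CoordAlg n :=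
  ∑ l, LinearMap.mulLeft ℝ (ExteriorAlgebra.ι ℝ (N (coframe n l))) ∘ₗ intProd l

theorem derivExt_apply (N : Module.Dual ℝ (Coord n) →ₗ[ℝ] Module.Dual ℝ (Coord n))
    (a : CoordAlg n) :
    derivExt N a = ∑ l, ExteriorAlgebra.ι ℝ (N (coframe n l)) * intProd l a := by
  simp [derivExt]

theorem derivExt_algebraMap (N : Module.Dual ℝ (Coord n) →ₗ[ℝ] Module.Dual ℝ (Coord n)) (r : ℝ) :
    derivExt N (algebraMap ℝ _ r) = 0 := by
  simp [derivExt_apply, intProd_algebraMap]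

theorem derivExt_ι (N : Module.Dual ℝ (Coord n) →ₗ[ℝ] Module.Dual ℝ (Coord n))
    (α : Module.Dual ℝ (Coord n)) :
    derivExt N (ExteriorAlgebra.ι ℝ α) = ExteriorAlgebra.ι ℝ (N α) := by
  conv_rhs => rw [← sum_apply_frame_smul_coframe α]
  simp only [derivExt_apply, intProd_ι, map_sum, map_smul]
  refine Finset.sum_congr rfl fun l _ => ?_
  rw [← Algebra.commutes, ← Algebra.smul_def]

/-- Wedging with a covector after contracting is even: the sign of the odd Leibniz rule cancels the
sign of moving the covector past `a`. -/
theorem derivExt_mul (N : Module.Dual ℝ (Coord n) →ₗ[ℝ] Module.Dual ℝ (Coord n))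
    (a b : CoordAlg n) : derivExt N (a * b) = derivExt N a * b + a * derivExt N b := by
  simp only [derivExt_apply, Finset.sum_mul, Finset.mul_sum, ← Finset.sum_add_distrib]
  refine Finset.sum_congr rfl fun l _ => ?_
  rw [intProd, contractLeft_mul, mul_add, ← mul_assoc, ← mul_assoc, ι_mul_involute, mul_assoc a]

theorem derivExt_add (N N' : Module.Dual ℝ (Coord n) →ₗ[ℝ] Module.Dual ℝ (Coord n))
    (a : CoordAlg n) : derivExt (N + N') a = derivExt N a + derivExt N' a := by
  simp [derivExt_apply, add_mul, Finset.sum_add_distrib]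

theorem derivExt_smul (r : ℝ) (N : Module.Dual ℝ (Coord n) →ₗ[ℝ] Module.Dual ℝ (Coord n))
    (a : CoordAlg n) : derivExt (r • N) a = r • derivExt N a := by
  simp [derivExt_apply, Finset.smul_sum]

theorem derivExt_mem {p : ℕ} (N : Module.Dual ℝ (Coord n) →ₗ[ℝ] Module.Dual ℝ (Coord n))
    {a : CoordAlg n} (ha : a ∈ ⋀[ℝ]^p (Module.Dual ℝ (Coord n))) :
    derivExt N a ∈ ⋀[ℝ]^p (Module.Dual ℝ (Coord n)) := by
  rw [derivExt_apply]
  refine Submodule.sum_mem _ fun l _ => ?_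
  rcases p with _ | p
  · rw [intProd, contractLeft_of_mem_zero _ ha, mul_zero]; exact Submodule.zero_mem _
  · rw [add_comm]
    exact SetLike.mul_mem_graded (A := fun i : ℕ => ⋀[ℝ]^i (Module.Dual ℝ (Coord n))) (by simp)
      (contractLeft_mem _ ha)

variable {B : Coord n → Matrix (Fin n) (Fin n) ℝ} {u : Coord n}

/-- Constant forms come first because generators suffice for them; variable forms follow by
expansion in the basis `dx^S`. -/
theorem contDiffAt_coMap_const {k : WithTop ℕ∞}
    (hB : ∀ l m, ContDiffAt ℝ k (fun v => B v l m) u) (c : CoordAlg n) :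
    ContDiffAt ℝ k (fun v => coMap (B v) c) u := by
  induction c using ExteriorAlgebra.induction with
  | algebraMap r => simpa using contDiffAt_const
  | ι α =>
    have : (fun v => coMap (B v) (ExteriorAlgebra.ι ℝ α)) = fun v =>
        ∑ l, ∑ m, (α (frame n l) * B v l m) • ExteriorAlgebra.ι ℝ (coframe n m) := by
      funext v
      rw [coMap, ExteriorAlgebra.map_apply_ι]
      conv_lhs => rw [← sum_apply_frame_smul_coframe α]
      simp [coEnd_coframe, mul_smul, Finset.smul_sum]
    rw [this]
    exact ContDiffAt.sum fun l _ => ContDiffAt.sum fun m _ =>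
      (contDiffAt_const.mul (hB l m)).fun_smul contDiffAt_const
  | mul a b ha hb => simpa using contDiffAt_wedge ha hb
  | add a b ha hb => simpa using ha.add hb

theorem coMap_eq_sum (a : Matrix (Fin n) (Fin n) ℝ) (c : CoordAlg n) :
    coMap a c = ∑ S, (formBasis n).repr c S • coMap a (formBasis n S) := by
  conv_lhs => rw [← (formBasis n).sum_repr c]
  simp only [map_sum, map_smul]

theorem contDiffAt_coMap {k : WithTop ℕ∞}
    (hB : ∀ l m, ContDiffAt ℝ k (fun v => B v l m) u) {θ : Coord n → CoordAlg n}
    (hθ : ContDiffAt ℝ k θ u) : ContDiffAt ℝ k (fun v => coMap (B v) (θ v)) u := by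
  have : (fun v => coMap (B v) (θ v)) =
      fun v => ∑ S, (formBasis n).repr (θ v) S • coMap (B v) (formBasis n S) := by
    funext v; exact coMap_eq_sum _ _
  rw [this]
  exact ContDiffAt.sum fun S _ =>
    (contDiffAt_form_iff.1 hθ S).fun_smul (contDiffAt_coMap_const hB _)

/-- A matrix function that solves `∂B = B N' + N B` intertwines, on forms, the derivative with the
derivations given by `N` and `N'`: the case of constant forms. -/
theorem fderiv_coMap_const (hB : ∀ l m, ContDiffAt ℝ 1 (fun v => B v l m) u) {X : Coord n}
    {N N' : Matrix (Fin n) (Fin n) ℝ}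
    (h : ∀ l m, fderiv ℝ (fun v => B v l m) u X = (B u * N' + N * B u) l m) (c : CoordAlg n) :
    fderiv ℝ (fun v => coMap (B v) c) u X =
      derivExt (coEnd N') (coMap (B u) c) + coMap (B u) (derivExt (coEnd N) c) := by
  have hd : ∀ c, DifferentiableAt ℝ (fun v => coMap (B v) c) u := fun c =>
    (contDiffAt_coMap_const hB c).differentiableAt (by simp)
  induction c using ExteriorAlgebra.induction with
  | algebraMap r => simp [derivExt_algebraMap]
  | ι α =>
    have : (fun v => coMap (B v) (ExteriorAlgebra.ι ℝ α)) = fun v =>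
        ∑ l, ∑ m, B v l m • (α (frame n l) • ExteriorAlgebra.ι ℝ (coframe n m)) := by
      funext v
      rw [coMap, ExteriorAlgebra.map_apply_ι]
      conv_lhs => rw [← sum_apply_frame_smul_coframe α]
      simp only [coEnd_coframe, Finset.smul_sum, map_sum, map_smul]
      exact Finset.sum_congr rfl fun l _ => Finset.sum_congr rfl fun m _ => smul_comm _ _ _
    have hBd := fun l m => (hB l m).differentiableAt (by simp)
    have e : coEnd N' (coEnd (B u) α) + coEnd (B u) (coEnd N α) =
        coEnd (B u * N' + N * B u) α := by
      rw [coEnd_add, coEnd_mul, coEnd_mul]; rfl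
    simp only [coMap, ExteriorAlgebra.map_apply_ι, derivExt_ι] at this ⊢
    rw [← map_add, e]
    conv_rhs => rw [← sum_apply_frame_smul_coframe α]
    rw [this, fderiv_fun_sum (fun l _ => DifferentiableAt.fun_sum fun m _ =>
      (hBd l m).smul_const _), sum_apply]
    simp only [map_sum, map_smul, coEnd_coframe, Finset.smul_sum]
    refine Finset.sum_congr rfl fun l _ => ?_
    rw [fderiv_fun_sum (fun m _ => (hBd l m).smul_const _), sum_apply]
    refine Finset.sum_congr rfl fun m _ => ?_
    rw [fderiv_smul_const (hBd l m), ContinuousLinearMap.smulRight_apply, h, smul_comm]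
  | mul a b ha hb =>
    simp only [map_mul]
    rw [fderiv_wedge (hd a) (hd b), ha, hb, derivExt_mul, derivExt_mul, map_add, map_mul, map_mul]
    noncomm_ring
  | add a b ha hb =>
    simp only [map_add]
    rw [fderiv_fun_add (hd a) (hd b), add_apply, ha, hb]
    abel

/-- Serves twice: with `B = g⁻¹` and `τ = id` for raising indices, and with `B` the Jacobian of `τ`
for a change of coordinates. -/
theorem fderiv_coMap_comp (hB : ∀ l m, ContDiffAt ℝ 1 (fun v => B v l m) u) {X : Coord n}
    {N N' : Matrix (Fin n) (Fin n) ℝ}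
    (h : ∀ l m, fderiv ℝ (fun v => B v l m) u X = (B u * N' + N * B u) l m)
    {τ : Coord n → Coord n} (hτ : DifferentiableAt ℝ τ u) {θ : Coord n → CoordAlg n}
    (hθ : DifferentiableAt ℝ θ (τ u)) :
    fderiv ℝ (fun v => coMap (B v) (θ (τ v))) u X =
      derivExt (coEnd N') (coMap (B u) (θ (τ u))) +
        coMap (B u) (fderiv ℝ θ (τ u) (fderiv ℝ τ u X) + derivExt (coEnd N) (θ (τ u))) := by
  have e : (fun v => coMap (B v) (θ (τ v))) =
      fun v => ∑ S, (formBasis n).repr (θ (τ v)) S • coMap (B v) (formBasis n S) := by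
    funext v; exact coMap_eq_sum _ _
  have hd : ∀ c, DifferentiableAt ℝ (fun v => coMap (B v) c) u := fun c =>
    (contDiffAt_coMap_const hB c).differentiableAt (by simp)
  have hr : ∀ S, HasFDerivAt (fun w => (formBasis n).repr (θ w) S)
      (((ContinuousLinearMap.proj (R := ℝ) (φ := fun _ : Finset (Fin n) => ℝ) S).comp
        (coeffEquiv n : CoordAlg n →L[ℝ] (Finset (Fin n) → ℝ))).comp (fderiv ℝ θ (τ u))) (τ u) :=
    fun S => ((ContinuousLinearMap.proj (R := ℝ) (φ := fun _ : Finset (Fin n) => ℝ) S).comp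
      (coeffEquiv n : CoordAlg n →L[ℝ] (Finset (Fin n) → ℝ))).hasFDerivAt.comp _ hθ.hasFDerivAt
  have hr' : ∀ S, HasFDerivAt (fun v => (formBasis n).repr (θ (τ v)) S) _ u :=
    fun S => (hr S).comp u hτ.hasFDerivAt
  rw [e, fderiv_fun_sum (fun S _ => (hr' S).differentiableAt.fun_smul (hd _)),
    sum_apply, map_add, add_left_comm, coMap_eq_sum (B u) (fderiv ℝ θ _ _)]
  have e2 : derivExt (coEnd N') (coMap (B u) (θ (τ u))) +
      coMap (B u) (derivExt (coEnd N) (θ (τ u))) = ∑ S, (formBasis n).repr (θ (τ u)) S •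
        (derivExt (coEnd N') (coMap (B u) (formBasis n S)) +
          coMap (B u) (derivExt (coEnd N) (formBasis n S))) := by
    conv_lhs => rw [← (formBasis n).sum_repr (θ (τ u))]
    simp only [map_sum, map_smul, smul_add, Finset.sum_add_distrib]
  rw [e2, ← Finset.sum_add_distrib]
  refine Finset.sum_congr rfl fun S _ => ?_
  have hS := fderiv_fun_smul (hr' S).differentiableAt (hd (formBasis n S))
  rw [hS, add_apply, smul_apply,
    ContinuousLinearMap.smulRight_apply, fderiv_coMap_const hB h, add_comm]
  rw [(hr' S).fderiv]
  rfl

end MatrixAction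

/-! ### Metrics in coordinates -/

section LocalMetric

variable {n : ℕ}

theorem pderiv_congr {f f' : Coord n → ℝ} {u : Coord n} (h : f =ᶠ[nhds u] f') (i : Fin n) :
    pderiv i f u = pderiv i f' u := by
  rw [pderiv, pderiv, h.fderiv_eq]

theorem contDiffAt_pderiv {f : Coord n → ℝ} {u : Coord n} (h : ContDiffAt ℝ ∞ f u) (i : Fin n) :
    ContDiffAt ℝ ∞ (pderiv i f) u :=
  (h.fderiv_right (m := ∞) (by simp)).clm_apply contDiffAt_const

theorem pderiv_mul {f f' : Coord n → ℝ} {u : Coord n} (h : DifferentiableAt ℝ f u)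
    (h' : DifferentiableAt ℝ f' u) (i : Fin n) :
    pderiv i (fun v => f v * f' v) u = pderiv i f u * f' u + f u * pderiv i f' u := by
  rw [pderiv, fderiv_fun_mul h h', pderiv, pderiv]
  simp only [add_apply, smul_apply, smul_eq_mul]
  ring

theorem pderiv_sum {ι : Type*} (s : Finset ι) {f : ι → Coord n → ℝ} {u : Coord n}
    (h : ∀ k ∈ s, DifferentiableAt ℝ (f k) u) (i : Fin n) :
    pderiv i (fun v => ∑ k ∈ s, f k v) u = ∑ k ∈ s, pderiv i (f k) u := by
  rw [pderiv, fderiv_fun_sum h, sum_apply]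
  rfl

theorem two_le_smoothness : minSmoothness ℝ 2 ≤ ∞ := by
  rw [minSmoothness_of_isRCLikeNormedField]
  exact WithTop.coe_le_coe.2 (le_top (a := (2 : ℕ∞)))

theorem pderiv_comm {f : Coord n → ℝ} {u : Coord n} (h : ContDiffAt ℝ ∞ f u) (i j : Fin n) :
    pderiv i (pderiv j f) u = pderiv j (pderiv i f) u := by
  have hs : IsSymmSndFDerivAt ℝ f u := h.isSymmSndFDerivAt two_le_smoothness
  have hd : DifferentiableAt ℝ (fderiv ℝ f) u :=
    (h.fderiv_right (m := ∞) (by simp)).differentiableAt (by simp)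
  have key : ∀ i j : Fin n, pderiv i (pderiv j f) u =
      fderiv ℝ (fderiv ℝ f) u (frame n i) (frame n j) := fun i j => by
    have : pderiv j f = fun v => fderiv ℝ f v (frame n j) := rfl
    rw [pderiv, this, fderiv_clm_apply hd (differentiableAt_const _)]
    simp
  rw [key, key]
  exact hs _ _

theorem fderiv_comm_form {P : Coord n → CoordAlg n} {u : Coord n} (h : ContDiffAt ℝ ∞ P u)
    (X Y : Coord n) :
    fderiv ℝ (fun v => fderiv ℝ P v Y) u X = fderiv ℝ (fun v => fderiv ℝ P v X) u Y := by
  have hs : IsSymmSndFDerivAt ℝ P u := h.isSymmSndFDerivAt two_le_smoothness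
  have hd : DifferentiableAt ℝ (fderiv ℝ P) u :=
    (h.fderiv_right (m := ∞) (by simp)).differentiableAt (by simp)
  have key : ∀ X Y : Coord n, fderiv ℝ (fun v => fderiv ℝ P v Y) u X =
      fderiv ℝ (fderiv ℝ P) u X Y := fun X Y => by
    rw [fderiv_clm_apply hd (differentiableAt_const _)]
    simp
  rw [key, key]
  exact hs _ _

theorem contDiffAt_det {k : WithTop ℕ∞} {ι : Type*} [Fintype ι] [DecidableEq ι]
    {A : Coord n → Matrix ι ι ℝ} {u : Coord n}
    (h : ∀ i j, ContDiffAt ℝ k (fun v => A v i j) u) : ContDiffAt ℝ k (fun v => (A v).det) u := by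
  simp only [Matrix.det_apply]
  refine ContDiffAt.sum fun σ _ => ?_
  exact (contDiffAt_prod fun i _ => h _ _).const_smul _

/-- By Cramer's formula the entries are quotients of determinants, so invertibility at the single
point `u` is enough. -/
theorem contDiffAt_matrix_inv {k : WithTop ℕ∞} {ι : Type*} [Fintype ι] [DecidableEq ι]
    {A : Coord n → Matrix ι ι ℝ} {u : Coord n}
    (h : ∀ i j, ContDiffAt ℝ k (fun v => A v i j) u) (hu : IsUnit (A u).det) (i j : ι) :
    ContDiffAt ℝ k (fun v => (A v)⁻¹ i j) u := by
  simp only [Matrix.inv_def, Matrix.smul_apply, smul_eq_mul, Ring.inverse_eq_inv',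
    Matrix.adjugate_apply]
  refine ((contDiffAt_det h).inv hu.ne_zero).mul (contDiffAt_det fun a b => ?_)
  simp only [Matrix.updateRow_apply]
  split_ifs
  · exact contDiffAt_const
  · exact h a b

/-- `g` is the component matrix of a smooth nondegenerate metric on the open set `U`. -/
structure IsLocalMetric (g : Coord n → Matrix (Fin n) (Fin n) ℝ) (U : Set (Coord n)) : Prop where
  isOpen : IsOpen U
  smooth : ∀ i j, ContDiffOn ℝ ∞ (fun v => g v i j) U
  symm : ∀ v ∈ U, (g v).transpose = g v
  det : ∀ v ∈ U, IsUnit (g v).det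

/-- The matrix of the partial derivatives `∂ⱼ gᵣₘ`. -/
def pderivMatrix (g : Coord n → Matrix (Fin n) (Fin n) ℝ) (j : Fin n) (u : Coord n) :
    Matrix (Fin n) (Fin n) ℝ :=
  Matrix.of fun r m => pderiv j (fun v => g v r m) u

/-- The connection matrix `(Γˡⱼₘ)` for fixed `j`. -/
def connMatrix (g : Coord n → Matrix (Fin n) (Fin n) ℝ) (j : Fin n) (u : Coord n) :
    Matrix (Fin n) (Fin n) ℝ :=
  Matrix.of fun l m => christoffel g l j m u

/-- The Christoffel symbols of the first kind, for fixed `j`. -/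
def lowConnMatrix (g : Coord n → Matrix (Fin n) (Fin n) ℝ) (j : Fin n) (u : Coord n) :
    Matrix (Fin n) (Fin n) ℝ :=
  Matrix.of fun r m => (1 / 2) * (pderivMatrix g j u r m + pderivMatrix g m u r j
    - pderivMatrix g r u j m)

/-- Splitting off the raising of the index turns the tensor computations below into matrix algebra.
-/
theorem connMatrix_eq (g : Coord n → Matrix (Fin n) (Fin n) ℝ) (j : Fin n) (u : Coord n) :
    connMatrix g j u = (g u)⁻¹ * lowConnMatrix g j u := by
  ext l m
  simp only [connMatrix, christoffel, lowConnMatrix, Matrix.mul_apply, Matrix.of_apply,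
    pderivMatrix, Finset.mul_sum]
  exact Finset.sum_congr rfl fun r _ => by ring

/-! ### Christoffel symbols and the derivative of the inverse metric -/

namespace IsLocalMetric

variable {g : Coord n → Matrix (Fin n) (Fin n) ℝ} {U : Set (Coord n)} {u : Coord n}

theorem mem_nhds (hg : IsLocalMetric g U) (hu : u ∈ U) : U ∈ nhds u := hg.isOpen.mem_nhds hu

theorem contDiffAt (hg : IsLocalMetric g U) (hu : u ∈ U) (i j : Fin n) : ContDiffAt ℝ ∞
    (fun v => g v i j) u :=
  (hg.smooth i j).contDiffAt (hg.mem_nhds hu)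

theorem contDiffAt_inv (hg : IsLocalMetric g U) (hu : u ∈ U) (i j : Fin n) : ContDiffAt ℝ ∞
    (fun v => (g v)⁻¹ i j) u :=
  contDiffAt_matrix_inv (hg.contDiffAt hu) (hg.det u hu) i j

theorem contDiffAt_christoffel (hg : IsLocalMetric g U) (hu : u ∈ U) (l j m : Fin n) :
    ContDiffAt ℝ ∞ (fun v => christoffel g l j m v) u := by
  unfold christoffel
  refine contDiffAt_const.mul (ContDiffAt.sum fun r _ => (hg.contDiffAt_inv hu l r).mul ?_)
  exact ((contDiffAt_pderiv (hg.contDiffAt hu _ _) _).add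
    (contDiffAt_pderiv (hg.contDiffAt hu _ _) _)).sub (contDiffAt_pderiv (hg.contDiffAt hu _ _) _)

theorem inv_symm (hg : IsLocalMetric g U) (hu : u ∈ U) : ((g u)⁻¹).transpose = (g u)⁻¹ := by
  rw [Matrix.transpose_nonsing_inv, hg.symm u hu]

theorem pderivMatrix_symm (hg : IsLocalMetric g U) (hu : u ∈ U) (j r m : Fin n) :
    pderivMatrix g j u r m = pderivMatrix g j u m r := by
  refine pderiv_congr ?_ j
  filter_upwards [hg.mem_nhds hu] with v hv
  exact congrFun (congrFun (hg.symm v hv) m) r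

theorem christoffel_symm (hg : IsLocalMetric g U) (hu : u ∈ U) (l j m : Fin n) :
    christoffel g l j m u = christoffel g l m j u := by
  unfold christoffel
  congr 1
  refine Finset.sum_congr rfl fun r _ => ?_
  have := hg.pderivMatrix_symm hu r j m
  simp only [pderivMatrix, Matrix.of_apply] at this
  rw [this]
  ring

theorem pderiv_inv (hg : IsLocalMetric g U) (hu : u ∈ U) (i l m : Fin n) :
    pderiv i (fun v => (g v)⁻¹ l m) u = -((g u)⁻¹ * pderivMatrix g i u * (g u)⁻¹) l m := by
  have hd := fun a b => (hg.contDiffAt hu a b).differentiableAt (by simp)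
  have hd' := fun a b => (hg.contDiffAt_inv hu a b).differentiableAt (by simp)
  -- Differentiate `g⁻¹ g = 1`.
  have h0 : pderivMatrix (fun v => (g v)⁻¹) i u * g u + (g u)⁻¹ * pderivMatrix g i u = 0 := by
    ext a b
    have hc : (fun v => ∑ k, (g v)⁻¹ a k * g v k b) =ᶠ[nhds u]
        fun _ => (1 : Matrix (Fin n) (Fin n) ℝ) a b := by
      filter_upwards [hg.mem_nhds hu] with v hv
      rw [← Matrix.mul_apply, Matrix.nonsing_inv_mul _ (hg.det v hv)]
    have h1 := pderiv_congr hc i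
    rw [pderiv_sum _ (fun k _ => (hd' a k).fun_mul (hd k b))] at h1
    simp only [pderiv_mul (hd' _ _) (hd _ _), Finset.sum_add_distrib] at h1
    simp only [Matrix.add_apply, Matrix.mul_apply, pderivMatrix, Matrix.of_apply, Matrix.zero_apply]
    rw [h1]
    simp [pderiv]
  have h2 : pderivMatrix (fun v => (g v)⁻¹) i u = -((g u)⁻¹ * pderivMatrix g i u * (g u)⁻¹) := by
    have h3 := congrArg (fun A => A * (g u)⁻¹) h0
    simp only [add_mul, zero_mul, mul_assoc (pderivMatrix (fun v => (g v)⁻¹) i u),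
      Matrix.mul_nonsing_inv _ (hg.det u hu), mul_one] at h3
    exact eq_neg_of_add_eq_zero_left h3
  exact congrFun (congrFun h2 l) m

/-- The inverse metric is parallel. -/
theorem pderiv_inv_eq_conn (hg : IsLocalMetric g U) (hu : u ∈ U) (j l m : Fin n) :
    pderiv j (fun v => (g v)⁻¹ l m) u =
      ((g u)⁻¹ * (-(connMatrix g j u).transpose) + (-connMatrix g j u) * (g u)⁻¹) l m := by
  -- Metric compatibility in terms of symbols of the first kind: `Γᵣⱼₘ + Γₘⱼᵣ = ∂ⱼ gᵣₘ`.
  have h : lowConnMatrix g j u + (lowConnMatrix g j u).transpose = pderivMatrix g j u := by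
    ext r m
    simp only [lowConnMatrix, Matrix.add_apply, Matrix.transpose_apply, Matrix.of_apply]
    rw [hg.pderivMatrix_symm hu j m r, hg.pderivMatrix_symm hu m j r, hg.pderivMatrix_symm hu r j m]
    ring
  rw [hg.pderiv_inv hu, ← h, connMatrix_eq, Matrix.transpose_mul, hg.inv_symm hu]
  rw [← Matrix.neg_apply]
  refine congrFun (congrFun ?_ l) m
  simp only [mul_add, add_mul, mul_neg, neg_mul, neg_add, mul_assoc]
  exact add_comm _ _

/-- The contracted Christoffel symbol is half the logarithmic derivative of the determinant. -/
theorem sum_christoffel (hg : IsLocalMetric g U) (hu : u ∈ U) (j : Fin n) :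
    ∑ l, christoffel g l l j u =
      (1 / 2) * ∑ l, ∑ r, (g u)⁻¹ l r * pderiv j (fun v => g v r l) u := by
  -- The other two terms of the Christoffel symbol cancel against the symmetric `gˡʳ`.
  have h : ∑ l, ∑ r, (g u)⁻¹ l r * pderivMatrix g l u r j =
      ∑ l, ∑ r, (g u)⁻¹ l r * pderivMatrix g r u l j := by
    rw [Finset.sum_comm]
    refine Finset.sum_congr rfl fun r _ => Finset.sum_congr rfl fun l _ => ?_
    have := congrFun (congrFun (hg.inv_symm hu) l) r
    rw [Matrix.transpose_apply] at this
    rw [this]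
  simp only [pderivMatrix, Matrix.of_apply] at h
  simp only [christoffel, mul_sub, mul_add, Finset.sum_add_distrib, Finset.sum_sub_distrib, ← Finset.mul_sum]
  rw [h]
  ring

/-- Closedness of `w = d log √|det g|`, proved without the logarithm: `∂ᵢ wⱼ` is a trace of four
matrices plus a contraction of second derivatives. The first is symmetric in `i, j` by cyclicity of
the trace, the second by equality of mixed partials. -/
theorem pderiv_sum_christoffel (hg : IsLocalMetric g U) (hu : u ∈ U) (i j : Fin n) :
    pderiv i (fun v => ∑ l, christoffel g l l j v) u =
      pderiv j (fun v => ∑ l, christoffel g l l i v) u := by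
  have key : ∀ i j : Fin n, pderiv i (fun v => ∑ l, christoffel g l l j v) u =
      (1 / 2) * (-((g u)⁻¹ * pderivMatrix g i u * (g u)⁻¹ * pderivMatrix g j u).trace +
        ∑ l, ∑ r, (g u)⁻¹ l r * pderiv i (pderiv j (fun v => g v r l)) u) := by
    intro i j
    have hc : (fun v => ∑ l, christoffel g l l j v) =ᶠ[nhds u] fun v =>
        ∑ l, ∑ r, (1 / 2) * ((g v)⁻¹ l r * pderiv j (fun v => g v r l) v) := by
      filter_upwards [hg.mem_nhds hu] with v hv
      rw [hg.sum_christoffel hv]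
      simp only [Finset.mul_sum]
    have hd := fun l r => (hg.contDiffAt_inv hu l r).differentiableAt (by simp)
    have hd2 := fun r l => (contDiffAt_pderiv (hg.contDiffAt hu r l) j).differentiableAt (by simp)
    rw [pderiv_congr hc, pderiv_sum _ fun l _ => DifferentiableAt.fun_sum fun r _ =>
      ((hd l r).fun_mul (hd2 r l)).const_mul _]
    simp only [Matrix.trace, Matrix.diag_apply, Matrix.mul_apply (N := pderivMatrix g j u),
      ← Finset.sum_neg_distrib, ← Finset.sum_add_distrib, Finset.mul_sum]
    refine Finset.sum_congr rfl fun l _ => ?_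
    rw [pderiv_sum _ fun r _ => ((hd l r).fun_mul (hd2 r l)).const_mul _]
    refine Finset.sum_congr rfl fun r _ => ?_
    rw [pderiv_mul (differentiableAt_const _) ((hd l r).fun_mul (hd2 r l)), pderiv_mul (hd l r) (hd2 r l),
      hg.pderiv_inv hu]
    simp [pderiv, pderivMatrix]
  rw [key, key]
  congr 2
  · rw [mul_assoc, Matrix.trace_mul_comm, ← mul_assoc]
  · refine Finset.sum_congr rfl fun l _ => Finset.sum_congr rfl fun r _ => ?_
    rw [pderiv_comm (hg.contDiffAt hu r l)]

end IsLocalMetric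

end LocalMetric

/-! ### The divergence in coordinates -/

section Divergence

variable {n : ℕ} {g : Coord n → Matrix (Fin n) (Fin n) ℝ} {U : Set (Coord n)} {u : Coord n}
  {θ η ζ : Coord n → CoordAlg n}

theorem coordNabla_eq (hθ : DifferentiableAt ℝ θ u) (j : Fin n) :
    coordNabla g j θ u =
      fderiv ℝ θ u (frame n j) - derivExt (coEnd (connMatrix g j u)) (θ u) := by
  rw [coordNabla, formPDeriv_eq hθ, derivExt_apply]
  congr 1
  refine Finset.sum_congr rfl fun l _ => ?_
  rw [coEnd_coframe, map_sum, Finset.sum_mul]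
  refine Finset.sum_congr rfl fun m _ => ?_
  rw [map_smul, smul_mul_assoc]
  rfl

theorem coordDiv_congr (h : θ =ᶠ[nhds u] η) : coordDiv g θ u = coordDiv g η u := by
  have h1 : ∀ j, formPDeriv j θ u = formPDeriv j η u := fun j => by
    unfold formPDeriv
    refine Finset.sum_congr rfl fun S _ => ?_
    rw [pderiv_congr]
    filter_upwards [h] with v hv
    rw [hv]
  simp only [coordDiv, coordNabla, h1, h.eq_of_nhds]

theorem coordNabla_mul (hθ : DifferentiableAt ℝ θ u) (hη : DifferentiableAt ℝ η u) (j : Fin n) :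
    coordNabla g j (fun v => θ v * η v) u =
      coordNabla g j θ u * η u + θ u * coordNabla g j η u := by
  rw [coordNabla_eq (differentiableAt_wedge hθ hη), coordNabla_eq hθ, coordNabla_eq hη,
    fderiv_wedge hθ hη, derivExt_mul]
  noncomm_ring

theorem coordNabla_mem {p : ℕ} (hθ : DifferentiableAt ℝ θ u)
    (h : ∀ᶠ v in nhds u, θ v ∈ ⋀[ℝ]^p (Module.Dual ℝ (Coord n))) (j : Fin n) :
    coordNabla g j θ u ∈ ⋀[ℝ]^p (Module.Dual ℝ (Coord n)) := by
  rw [coordNabla_eq hθ]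
  exact Submodule.sub_mem _ (fderiv_mem_submodule _ h _) (derivExt_mem _ h.self_of_nhds)

theorem coordDiv_mem {p : ℕ} (hθ : DifferentiableAt ℝ θ u)
    (h : ∀ᶠ v in nhds u, θ v ∈ ⋀[ℝ]^(p + 1) (Module.Dual ℝ (Coord n))) :
    coordDiv g θ u ∈ ⋀[ℝ]^p (Module.Dual ℝ (Coord n)) :=
  Submodule.sum_mem _ fun _ _ => Submodule.sum_mem _ fun j _ =>
    Submodule.smul_mem _ _ (contractLeft_mem _ (coordNabla_mem hθ h j))

theorem coordDiv_eq_zero (hθ : DifferentiableAt ℝ θ u)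
    (h : ∀ᶠ v in nhds u, θ v ∈ ⋀[ℝ]^0 (Module.Dual ℝ (Coord n))) :
    coordDiv g θ u = 0 := by
  refine Finset.sum_eq_zero fun i _ => Finset.sum_eq_zero fun j _ => ?_
  rw [intProd, contractLeft_of_mem_zero _ (coordNabla_mem hθ h j), smul_zero]

theorem coordDiv_add (hθ : DifferentiableAt ℝ θ u) (hη : DifferentiableAt ℝ η u) :
    coordDiv g (fun v => θ v + η v) u = coordDiv g θ u + coordDiv g η u := by
  simp only [coordDiv, ← Finset.sum_add_distrib, ← smul_add, ← map_add]
  refine Finset.sum_congr rfl fun i _ => Finset.sum_congr rfl fun j _ => ?_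
  rw [coordNabla_eq hθ, coordNabla_eq hη, coordNabla_eq (hθ.fun_add hη), fderiv_fun_add hθ hη,
    map_add, add_apply, add_sub_add_comm]

/-- The extra term is contraction with the gradient of `a`: it is the source of the associated
bilinear form. For constant `a` it vanishes, which gives `ℝ`-linearity. -/
theorem coordDiv_smul (hθ : DifferentiableAt ℝ θ u) {a : Coord n → ℝ}
    (ha : DifferentiableAt ℝ a u) :
    coordDiv g (fun v => a v • θ v) u = a u • coordDiv g θ u +
      ∑ i, ∑ j, ((g u)⁻¹ i j * pderiv j a u) • intProd i (θ u) := by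
  simp only [coordDiv, Finset.smul_sum, ← Finset.sum_add_distrib]
  refine Finset.sum_congr rfl fun i _ => Finset.sum_congr rfl fun j _ => ?_
  have h : coordNabla g j (fun v => a v • θ v) u =
      a u • coordNabla g j θ u + pderiv j a u • θ u := by
    rw [coordNabla_eq hθ, coordNabla_eq (ha.fun_smul hθ), fderiv_fun_smul ha hθ, map_smul,
      add_apply, smul_apply, ContinuousLinearMap.smulRight_apply, smul_sub, pderiv]
    abel
  rw [h, map_add, map_smul, map_smul, smul_add, mul_smul, smul_comm (a u)]

/-- The 7-term identity is linear in the operator, also over functions, so it is checked for each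
`ι_{∂ᵢ} ∇ⱼ` separately. -/
theorem coordDiv_seven_term {p q : ℕ} (hθ : DifferentiableAt ℝ θ u) (hη : DifferentiableAt ℝ η u)
    (hζ : DifferentiableAt ℝ ζ u)
    (hp : ∀ᶠ v in nhds u, θ v ∈ ⋀[ℝ]^p (Module.Dual ℝ (Coord n)))
    (hq : ∀ᶠ v in nhds u, η v ∈ ⋀[ℝ]^q (Module.Dual ℝ (Coord n))) :
    coordDiv g (fun v => θ v * η v * ζ v) u =
      coordDiv g (fun v => θ v * η v) u * ζ u + (-1) ^ p * (θ u * coordDiv g (fun v => η v * ζ v) u)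
        + (-1) ^ ((p + 1) * q) * (η u * coordDiv g (fun v => θ v * ζ v) u)
        - coordDiv g θ u * η u * ζ u - (-1) ^ p * (θ u * coordDiv g η u * ζ u)
        - (-1) ^ (p + q) * (θ u * η u * coordDiv g ζ u) := by
  simp only [coordDiv, Finset.mul_sum, Finset.sum_mul, ← Finset.sum_add_distrib,
    ← Finset.sum_sub_distrib]
  refine Finset.sum_congr rfl fun i _ => Finset.sum_congr rfl fun j _ => ?_
  simp only [mul_smul_comm, smul_mul_assoc, ← smul_add, ← smul_sub]
  congr 1
  rw [coordNabla_mul (differentiableAt_wedge hθ hη) hζ, coordNabla_mul hθ hη, coordNabla_mul hη hζ,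
    coordNabla_mul hθ hζ, add_mul (coordNabla g j θ u * η u)]
  exact seven_term_of_derivation _ hp.self_of_nhds (coordNabla_mem hθ hp j) hq.self_of_nhds
    (coordNabla_mem hη hq j) _ _

theorem contDiffAt_coordDiv (hg : IsLocalMetric g U) (hu : u ∈ U) (hθ : ContDiffAt ℝ ∞ θ u) :
    ContDiffAt ℝ ∞ (coordDiv g θ) u := by
  unfold coordDiv coordNabla
  refine ContDiffAt.sum fun i _ => ContDiffAt.sum fun j _ => (hg.contDiffAt_inv hu i j).fun_smul
    (contDiffAt_linear _ (ContDiffAt.sub ?_ (ContDiffAt.sum fun l _ => ContDiffAt.sum fun m _ =>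
      (hg.contDiffAt_christoffel hu l j m).fun_smul
        (contDiffAt_wedge contDiffAt_const (contDiffAt_linear _ hθ)))))
  exact ContDiffAt.sum fun S _ =>
    (contDiffAt_pderiv (contDiffAt_form_iff.1 hθ S) j).fun_smul contDiffAt_const

theorem eq_zero_of_eq_neg_self {a : CoordAlg n} (h : a = -a) : a = 0 := by
  have h2 : (2 : ℝ) • a = 0 := by
    rw [two_smul]
    nth_rewrite 2 [h]
    exact add_neg_cancel a
  simpa using h2

theorem sum_intProd_intProd_of_symm {S : Fin n → Fin n → CoordAlg n} (hS : ∀ k j, S j k = S k j) :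
    ∑ k, ∑ j, intProd k (intProd j (S k j)) = 0 := by
  refine eq_zero_of_eq_neg_self ?_
  conv_lhs => rw [Finset.sum_comm]
  rw [← Finset.sum_neg_distrib]
  refine Finset.sum_congr rfl fun k _ => ?_
  rw [← Finset.sum_neg_distrib]
  refine Finset.sum_congr rfl fun j _ => ?_
  rw [intProd_comm, hS]

theorem derivExt_coEnd_neg (a : Matrix (Fin n) (Fin n) ℝ) (c : CoordAlg n) :
    derivExt (coEnd (-a)) c = -derivExt (coEnd a) c := by
  rw [← neg_one_smul ℝ a, coEnd_smul, derivExt_smul, neg_one_smul]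

/-- Contracting the connection term leaves only the trace of the connection: the rest pairs the
symmetric lower indices of `Γ` with two anticommuting contractions. -/
theorem sum_intProd_derivExt_of_symm {Γ : Fin n → Matrix (Fin n) (Fin n) ℝ}
    (hΓ : ∀ l j m, Γ j l m = Γ m l j) (P : CoordAlg n) :
    ∑ j, intProd j (derivExt (coEnd (Γ j).transpose) P) =
      ∑ j, (∑ l, Γ l l j) • intProd j P := by
  have e : ∀ j, intProd j (derivExt (coEnd (Γ j).transpose) P) =
      ∑ m, (Γ j j m • intProd m P - ∑ l, Γ j l m • (ExteriorAlgebra.ι ℝ (coframe n l) *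
        intProd j (intProd m P))) := by
    intro j
    rw [derivExt_apply, map_sum]
    refine Finset.sum_congr rfl fun m _ => ?_
    have h1 : ∑ l, Γ j l m • (if j = l then (1 : ℝ) else 0) • intProd m P =
        Γ j j m • intProd m P := by
      rw [Finset.sum_eq_single j (fun l _ hl => by rw [if_neg hl.symm, zero_smul, smul_zero])
        (fun h => absurd (Finset.mem_univ j) h), if_pos rfl, one_smul]
    rw [coEnd_coframe, map_sum, Finset.sum_mul, map_sum, ← h1, ← Finset.sum_sub_distrib]
    refine Finset.sum_congr rfl fun l _ => ?_
    rw [map_smul, smul_mul_assoc, map_smul, intProd_ι_mul, coframe_apply_frame,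
      Matrix.transpose_apply, smul_sub]
  have e2 : ∑ j, ∑ m, ∑ l, Γ j l m • (ExteriorAlgebra.ι ℝ (coframe n l) *
        intProd j (intProd m P)) = 0 := by
    refine eq_zero_of_eq_neg_self ?_
    conv_lhs => rw [Finset.sum_comm]
    rw [← Finset.sum_neg_distrib]
    refine Finset.sum_congr rfl fun j _ => ?_
    rw [← Finset.sum_neg_distrib]
    refine Finset.sum_congr rfl fun m _ => ?_
    rw [← Finset.sum_neg_distrib]
    refine Finset.sum_congr rfl fun l _ => ?_
    rw [hΓ, intProd_comm, mul_neg, smul_neg]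
  rw [Finset.sum_congr rfl fun j _ => e j]
  simp only [Finset.sum_sub_distrib]
  rw [e2, sub_zero, Finset.sum_comm]
  exact Finset.sum_congr rfl fun m _ => (Finset.sum_smul).symm

/-- In terms of polyvector fields the divergence is `∑ ιʲ (∂ⱼ + wⱼ)` with `wⱼ = Γˡₗⱼ`. Raising the
indices is written as the endomorphism `dxⁱ ↦ ∑ gⁱʲ dxʲ`. -/
theorem coMap_inv_coordDiv (hg : IsLocalMetric g U) (hu : u ∈ U) (hθ : DifferentiableAt ℝ θ u) :
    coMap (g u)⁻¹ (coordDiv g θ u) =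
      ∑ j, intProd j (fderiv ℝ (fun v => coMap (g v)⁻¹ (θ v)) u (frame n j) +
        (∑ l, christoffel g l l j u) • coMap (g u)⁻¹ (θ u)) := by
  -- Raising indices intertwines the two covariant derivatives because `g⁻¹` is parallel; on raised
  -- forms the connection acts by the transposed matrix, with the opposite sign.
  have h1 : ∀ j, coMap (g u)⁻¹ (coordNabla g j θ u) =
      fderiv ℝ (fun v => coMap (g v)⁻¹ (θ v)) u (frame n j) +
      derivExt (coEnd (connMatrix g j u).transpose) (coMap (g u)⁻¹ (θ u)) := fun j => by
    have := fderiv_coMap_comp (X := frame n j) (u := u) (B := fun v => (g v)⁻¹)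
      (fun l m => (hg.contDiffAt_inv hu l m).of_le (by simp))
      (fun l m => hg.pderiv_inv_eq_conn hu j l m) (τ := id) differentiableAt_id (θ := θ) hθ
    rw [fderiv_id, ContinuousLinearMap.id_apply] at this
    simp only [id] at this
    rw [this, coordNabla_eq hθ, sub_eq_add_neg, derivExt_coEnd_neg, derivExt_coEnd_neg]
    abel
  have h2 : coMap (g u)⁻¹ (coordDiv g θ u) =
      ∑ j, intProd j (coMap (g u)⁻¹ (coordNabla g j θ u)) := by
    simp only [coordDiv, intProd_coMap, map_sum, map_smul]
    exact Finset.sum_comm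
  have h3 := sum_intProd_derivExt_of_symm (Γ := fun j => connMatrix g j u)
    (fun l j m => hg.christoffel_symm hu l j m) (coMap (g u)⁻¹ (θ u))
  rw [h2, Finset.sum_congr rfl fun j _ => congrArg (intProd j) (h1 j)]
  simp only [map_add, map_smul, Finset.sum_add_distrib]
  rw [h3]
  rfl

/-- After raising indices the square is `∑ ιₖ ιⱼ (∂ₖ + wₖ)(∂ⱼ + wⱼ) P`. The operators commute since
mixed partials agree and `w` is closed, while the contractions anticommute. -/
theorem coordDiv_coordDiv (hg : IsLocalMetric g U) (hu : u ∈ U) (hθ : ContDiffOn ℝ ∞ θ U) :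
    coordDiv g (coordDiv g θ) u = 0 := by
  have hθ' : ∀ v ∈ U, ContDiffAt ℝ ∞ θ v := fun v hv => hθ.contDiffAt (hg.mem_nhds hv)
  have hdet : IsUnit ((g u)⁻¹).det := by
    rw [Matrix.isUnit_nonsing_inv_det_iff]; exact hg.det u hu
  refine coMap_injective hdet ?_
  rw [map_zero, coMap_inv_coordDiv hg hu
    ((contDiffAt_coordDiv hg hu (hθ' u hu)).differentiableAt (by simp))]
  set P := fun v => coMap (g v)⁻¹ (θ v) with hP
  set w : Fin n → Coord n → ℝ := fun j v => ∑ l, christoffel g l l j v with hw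
  have hPs : ContDiffAt ℝ ∞ P u := contDiffAt_coMap (hg.contDiffAt_inv hu) (hθ' u hu)
  have hPd : DifferentiableAt ℝ P u := hPs.differentiableAt (by simp)
  have hwd : ∀ j, DifferentiableAt ℝ (w j) u := fun j =>
    (ContDiffAt.sum fun l _ => hg.contDiffAt_christoffel hu l l j).differentiableAt
      (n := ∞) (by simp)
  have hdP : ∀ j, DifferentiableAt ℝ (fun v => fderiv ℝ P v (frame n j)) u := fun j =>
    ((hPs.fderiv_right (m := ∞) (by simp)).clm_apply contDiffAt_const).differentiableAt (by simp)
  -- The formula is needed on a neighbourhood, since the inner divergence is differentiated again.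
  have hQ : (fun v => coMap (g v)⁻¹ (coordDiv g θ v)) =ᶠ[nhds u] fun v =>
      ∑ j, intProd j (fderiv ℝ P v (frame n j) + w j v • P v) := by
    filter_upwards [hg.mem_nhds hu] with v hv
    exact coMap_inv_coordDiv hg hv ((hθ' v hv).differentiableAt (by simp))
  have hdj : ∀ j, DifferentiableAt ℝ (fun v => fderiv ℝ P v (frame n j) + w j v • P v) u :=
    fun j => (hdP j).fun_add ((hwd j).fun_smul hPd)
  have e : ∀ k, fderiv ℝ (fun v => coMap (g v)⁻¹ (coordDiv g θ v)) u (frame n k) +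
      w k u • coMap (g u)⁻¹ (coordDiv g θ u) =
      ∑ j, intProd j (fderiv ℝ (fun v => fderiv ℝ P v (frame n j)) u (frame n k) +
        (w j u • fderiv ℝ P u (frame n k) + pderiv k (w j) u • P u) +
        w k u • (fderiv ℝ P u (frame n j) + w j u • P u)) := by
    intro k
    rw [hQ.fderiv_eq, hQ.eq_of_nhds,
      fderiv_fun_sum (fun j _ => differentiableAt_linear (intProd j) (hdj j)), sum_apply,
      Finset.smul_sum, ← Finset.sum_add_distrib]
    refine Finset.sum_congr rfl fun j _ => ?_
    rw [fderiv_linear _ (hdj j), fderiv_fun_add (hdP j) ((hwd j).fun_smul hPd), add_apply,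
      fderiv_fun_smul (hwd j) hPd, add_apply, smul_apply, ContinuousLinearMap.smulRight_apply,
      map_add _ _ (w k u • _), map_smul]
    rfl
  refine (Finset.sum_congr rfl fun k _ => ?_).trans (sum_intProd_intProd_of_symm
    (S := fun k j => fderiv ℝ (fun v => fderiv ℝ P v (frame n j)) u (frame n k) +
        (w j u • fderiv ℝ P u (frame n k) + pderiv k (w j) u • P u) +
        w k u • (fderiv ℝ P u (frame n j) + w j u • P u)) fun k j => ?_)
  · rw [← map_sum, ← e k]
  · rw [fderiv_comm_form hPs (frame n j) (frame n k), hg.pderiv_sum_christoffel hu j k, smul_add,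
      smul_add, smul_comm (w k u)]
    abel

end Divergence

/-! ### Change of coordinates -/

section ChangeOfCoordinates

variable {n : ℕ}

theorem sum_coframe_smul_frame (w : Coord n) : ∑ k, coframe n k w • frame n k = w := by
  simp [coframe]

/-- The matrix of a linear map in the standard basis. -/
def linMatrix (L : Coord n →ₗ[ℝ] Coord n) : Matrix (Fin n) (Fin n) ℝ :=
  Matrix.of fun a r => coframe n a (L (frame n r))

/-- Hence `coMap` of a Jacobian matrix is the pullback of forms. -/
theorem coEnd_linMatrix (L : Coord n →ₗ[ℝ] Coord n) :
    coEnd (linMatrix L) = Module.Dual.transpose (R := ℝ) L := by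
  refine LinearMap.ext fun α => (frame n).ext fun i => ?_
  rw [coEnd_apply_frame, Module.Dual.transpose_apply, LinearMap.comp_apply]
  conv_rhs => rw [← sum_apply_frame_smul_coframe α]
  simp [linMatrix]

theorem linMatrix_comp (L L' : Coord n →ₗ[ℝ] Coord n) :
    linMatrix (L ∘ₗ L') = linMatrix L * linMatrix L' := by
  ext a r
  rw [Matrix.mul_apply]
  simp only [linMatrix, Matrix.of_apply, LinearMap.comp_apply]
  conv_lhs => rw [← sum_coframe_smul_frame (L' (frame n r))]
  simp [mul_comm]

theorem linMatrix_id : linMatrix (LinearMap.id : Coord n →ₗ[ℝ] Coord n) = 1 := by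
  ext a r
  simp [linMatrix, coframe_apply_frame, Matrix.one_apply, eq_comm]

/-- The Jacobian matrix. -/
def jacobian (τ : Coord n → Coord n) (u : Coord n) : Matrix (Fin n) (Fin n) ℝ :=
  linMatrix (fderiv ℝ τ u).toLinearMap

variable {τ : Coord n → Coord n} {u : Coord n}

theorem fderiv_frame (j : Fin n) :
    fderiv ℝ τ u (frame n j) = ∑ k, jacobian τ u k j • frame n k :=
  (sum_coframe_smul_frame _).symm

theorem contDiffAt_jacobian (hτ : ContDiffAt ℝ ∞ τ u) (a r : Fin n) :
    ContDiffAt ℝ ∞ (fun v => jacobian τ v a r) u :=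
  (LinearMap.toContinuousLinearMap (coframe n a)).contDiff.contDiffAt.comp u
    ((hτ.fderiv_right (m := ∞) (by simp)).clm_apply contDiffAt_const)

theorem pderiv_jacobian_symm (hτ : ContDiffAt ℝ ∞ τ u) (j a r : Fin n) :
    pderiv j (fun v => jacobian τ v a r) u = pderiv r (fun v => jacobian τ v a j) u := by
  have hs : ContDiffAt ℝ ∞ (fun v => coframe n a (τ v)) u :=
    (LinearMap.toContinuousLinearMap (coframe n a)).contDiff.contDiffAt.comp u hτ
  have key : ∀ r, (fun v => jacobian τ v a r) =ᶠ[nhds u] pderiv r (fun v => coframe n a (τ v)) := by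
    intro r
    filter_upwards [(hτ.of_le (m := 1) (by simp)).eventually (by simp)] with v hv
    have h := (LinearMap.toContinuousLinearMap (coframe n a)).hasFDerivAt.comp v
      (hv.differentiableAt (by simp)).hasFDerivAt
    have h' : HasFDerivAt (fun v => coframe n a (τ v)) _ v := h
    rw [pderiv, h'.fderiv]
    rfl
  rw [pderiv_congr (key r), pderiv_congr (key j), pderiv_comm hs]

/-- The algebra behind the transformation law of the Christoffel symbols of the first kind:
`J` is the Jacobian, `H` its derivative, `G` the metric and `D` its derivative. -/
theorem koszul_transform (J G : Matrix (Fin n) (Fin n) ℝ) (H D : Fin n → Matrix (Fin n) (Fin n) ℝ)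
    (hG : ∀ a b, G a b = G b a) (hH : ∀ j a r, H j a r = H r a j)
    (d : Fin n → Fin n → Fin n → ℝ)
    (hd : ∀ j r m, d j r m = ∑ a, ∑ b, (H j a r * G a b * J b m +
      J a r * (∑ k, J k j * D k a b) * J b m + J a r * G a b * H j b m)) (j r m : Fin n) :
    (1 / 2) * (d j r m + d m r j - d r j m) =
      ∑ a, ∑ b, J a r * (∑ k, J k j * ((1 / 2) * (D k a b + D b a k - D a k b))) * J b m +
        ∑ a, ∑ b, J a r * G a b * H j b m := by
  -- `P` is the part that transforms like a tensor, `Q` collects the second derivatives of the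
  -- coordinate change.
  set P : Fin n → Fin n → Fin n → ℝ := fun j r m =>
    ∑ a, ∑ b, ∑ k, J a r * J b m * J k j * D k a b with hP
  set Q : Fin n → Fin n → Fin n → ℝ := fun j r m => ∑ a, ∑ b, H j a r * G a b * J b m with hQ
  have hQs : ∀ j r m, Q j r m = Q r j m := fun j r m => by
    simp only [hQ]
    exact Finset.sum_congr rfl fun a _ => Finset.sum_congr rfl fun b _ => by rw [hH]
  have hQ' : ∀ j r m, ∑ a, ∑ b, J a r * G a b * H j b m = Q j m r := fun j r m => by
    simp only [hQ]
    rw [Finset.sum_comm]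
    exact Finset.sum_congr rfl fun a _ => Finset.sum_congr rfl fun b _ => by rw [hG]; ring
  have hP' : ∀ j r m, ∑ a, ∑ b, J a r * (∑ k, J k j * D k a b) * J b m = P j r m := fun j r m => by
    simp only [hP]
    refine Finset.sum_congr rfl fun a _ => Finset.sum_congr rfl fun b _ => ?_
    rw [Finset.mul_sum, Finset.sum_mul]
    exact Finset.sum_congr rfl fun k _ => by ring
  have hd' : ∀ j r m, d j r m = Q j r m + P j r m + Q j m r := fun j r m => by
    rw [hd]
    simp only [Finset.sum_add_distrib]
    rw [hQ', hP']
  have e1 : P m r j = ∑ a, ∑ b, ∑ k, J a r * J b m * J k j * D b a k := by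
    simp only [hP]
    refine Finset.sum_congr rfl fun a _ => ?_
    rw [Finset.sum_comm]
    exact Finset.sum_congr rfl fun b _ => Finset.sum_congr rfl fun k _ => by ring
  have e2 : P r j m = ∑ a, ∑ b, ∑ k, J a r * J b m * J k j * D a k b := by
    simp only [hP]
    rw [Finset.sum_comm]
    rw [Finset.sum_comm (f := fun a b => ∑ k, J a r * J b m * J k j * D a k b)]
    refine Finset.sum_congr rfl fun b _ => ?_
    rw [Finset.sum_comm]
    exact Finset.sum_congr rfl fun a _ => Finset.sum_congr rfl fun k _ => by ring
  have e3 : ∑ a, ∑ b, J a r * (∑ k, J k j * ((1 / 2) * (D k a b + D b a k - D a k b))) * J b m =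
      (1 / 2) * (P j r m + P m r j - P r j m) := by
    rw [e1, e2]
    simp only [hP, Finset.mul_sum, ← Finset.sum_add_distrib, ← Finset.sum_sub_distrib,
      Finset.sum_mul]
    exact Finset.sum_congr rfl fun a _ => Finset.sum_congr rfl fun b _ =>
      Finset.sum_congr rfl fun k _ => by ring
  -- Of the six `Q` terms in the Koszul combination, four cancel by symmetry in the first two
  -- indices and two coincide; the factor `1 / 2` leaves one `Q`.
  rw [e3, hQ', hd', hd', hd', hQs j r m, hQs m r j, hQs m j r]
  ring

variable {g g' : Coord n → Matrix (Fin n) (Fin n) ℝ} {U : Set (Coord n)}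

theorem inv_transform (hJ : IsUnit (jacobian τ u).det)
    (hgu : g' u = (jacobian τ u).transpose * g (τ u) * jacobian τ u) :
    jacobian τ u * (g' u)⁻¹ * (jacobian τ u).transpose = (g (τ u))⁻¹ := by
  have hJt : IsUnit (jacobian τ u).transpose.det := by rwa [Matrix.det_transpose]
  rw [hgu, Matrix.mul_inv_rev, Matrix.mul_inv_rev, ← mul_assoc, Matrix.mul_nonsing_inv _ hJ,
    one_mul, mul_assoc, Matrix.nonsing_inv_mul _ hJt, mul_one]

/-- The inhomogeneous transformation law, multiplied by the Jacobian `J` so that no inverse appears.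
Solved for `∂ⱼ J`, it is the hypothesis that `fderiv_coMap_comp` requires. -/
theorem connMatrix_transform (hg : IsLocalMetric g U) (hu : τ u ∈ U) (hτ : ContDiffAt ℝ ∞ τ u)
    (hJ : IsUnit (jacobian τ u).det)
    (hgg : ∀ᶠ v in nhds u, g' v = (jacobian τ v).transpose * g (τ v) * jacobian τ v) (j : Fin n) :
    jacobian τ u * connMatrix g' j u =
      (∑ k, jacobian τ u k j • connMatrix g k (τ u)) * jacobian τ u +
        pderivMatrix (jacobian τ) j u := by
  set J := jacobian τ u with hJdef
  have hgu : g' u = J.transpose * g (τ u) * J := hgg.self_of_nhds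
  have hgd := hg.det _ hu
  have hd : ∀ j r m, pderivMatrix g' j u r m = ∑ a, ∑ b,
      (pderivMatrix (jacobian τ) j u a r * g (τ u) a b * J b m +
      J a r * (∑ k, J k j * pderivMatrix g k (τ u) a b) * J b m +
      J a r * g (τ u) a b * pderivMatrix (jacobian τ) j u b m) := by
    intro j r m
    have hc : (fun v => g' v r m) =ᶠ[nhds u] fun v => ∑ a, ∑ b,
        jacobian τ v a r * g (τ v) a b * jacobian τ v b m := by
      filter_upwards [hgg] with v hv
      rw [hv, Matrix.mul_assoc, Matrix.mul_apply]
      refine Finset.sum_congr rfl fun a _ => ?_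
      rw [Matrix.mul_apply, Finset.mul_sum]
      exact Finset.sum_congr rfl fun b _ => by rw [Matrix.transpose_apply, mul_assoc]
    have hJd := fun a r => (contDiffAt_jacobian hτ a r).differentiableAt (by simp)
    have hτd : DifferentiableAt ℝ τ u := hτ.differentiableAt (by simp)
    have hgd := fun a b => (hg.contDiffAt hu a b).differentiableAt (by simp)
    have hgτ : ∀ a b, DifferentiableAt ℝ (fun v => g (τ v) a b) u := fun a b =>
      (hgd a b).comp u hτd
    have hch : ∀ a b, pderiv j (fun v => g (τ v) a b) u =
        ∑ k, J k j * pderivMatrix g k (τ u) a b := fun a b => by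
      have h := (hgd a b).hasFDerivAt.comp u hτd.hasFDerivAt
      have h' : HasFDerivAt (fun v => g (τ v) a b) _ u := h
      rw [pderiv, h'.fderiv, ContinuousLinearMap.comp_apply, fderiv_frame, map_sum]
      simp only [map_smul, smul_eq_mul]
      rfl
    have hprod := fun a b => ((hJd a r).fun_mul (hgτ a b)).fun_mul (hJd b m)
    rw [pderivMatrix, Matrix.of_apply, pderiv_congr hc,
      pderiv_sum _ (fun a _ => DifferentiableAt.fun_sum fun b _ => hprod a b)]
    refine Finset.sum_congr rfl fun a _ => ?_
    rw [pderiv_sum _ (fun b _ => hprod a b)]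
    refine Finset.sum_congr rfl fun b _ => ?_
    rw [pderiv_mul ((hJd a r).fun_mul (hgτ a b)) (hJd b m), pderiv_mul (hJd a r) (hgτ a b), hch]
    simp only [pderivMatrix, Matrix.of_apply]
    ring
  have hlow : lowConnMatrix g' j u = J.transpose * (∑ k, J k j • lowConnMatrix g k (τ u)) * J +
      J.transpose * g (τ u) * pderivMatrix (jacobian τ) j u := by
    ext r m
    have h := koszul_transform J (g (τ u)) (fun j => pderivMatrix (jacobian τ) j u)
      (fun k => pderivMatrix g k (τ u))
      (fun a b => (congrFun (congrFun (hg.symm _ hu) b) a))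
      (fun j a r => pderiv_jacobian_symm hτ j a r) _ hd j r m
    rw [lowConnMatrix, Matrix.of_apply, h, Matrix.add_apply, Matrix.mul_assoc, Matrix.mul_assoc,
      Matrix.mul_apply, Matrix.mul_apply]
    congr 1
    · refine Finset.sum_congr rfl fun a _ => ?_
      rw [Matrix.mul_apply, Finset.mul_sum]
      refine Finset.sum_congr rfl fun b _ => ?_
      rw [Matrix.transpose_apply, mul_assoc, Matrix.sum_apply]
      rfl
    · refine Finset.sum_congr rfl fun a _ => ?_
      rw [Matrix.mul_apply, Finset.mul_sum]
      exact Finset.sum_congr rfl fun b _ => by rw [Matrix.transpose_apply, mul_assoc]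
  rw [connMatrix_eq, hlow, ← mul_assoc, mul_add]
  simp only [← mul_assoc]
  rw [inv_transform hJ hgu, Matrix.nonsing_inv_mul _ hgd, one_mul, Finset.mul_sum]
  simp only [connMatrix_eq, Matrix.mul_smul]

/-- The divergence commutes with the pullback under a local diffeomorphism. -/
theorem coordDiv_pullback (hg : IsLocalMetric g U) (hu : τ u ∈ U) (hτ : ContDiffAt ℝ ∞ τ u)
    (hJ : IsUnit (jacobian τ u).det)
    (hgg : ∀ᶠ v in nhds u, g' v = (jacobian τ v).transpose * g (τ v) * jacobian τ v)
    {θ : Coord n → CoordAlg n} (hθ : ContDiffAt ℝ ∞ θ (τ u)) :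
    coordDiv g' (fun v => coMap (jacobian τ v) (θ (τ v))) u =
      coMap (jacobian τ u) (coordDiv g θ (τ u)) := by
  have hτd : DifferentiableAt ℝ τ u := hτ.differentiableAt (by simp)
  have hθd : DifferentiableAt ℝ θ (τ u) := hθ.differentiableAt (by simp)
  -- The covariant derivative is natural: the derivation `N'` cancels the connection term of `g'`,
  -- and `N` supplies that of `g` at the image point.
  have hnabla : ∀ j, coordNabla g' j (fun v => coMap (jacobian τ v) (θ (τ v))) u =
      ∑ k, jacobian τ u k j • coMap (jacobian τ u) (coordNabla g k θ (τ u)) := by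
    intro j
    have hpull : DifferentiableAt ℝ (fun v => coMap (jacobian τ v) (θ (τ v))) u :=
      (contDiffAt_coMap (contDiffAt_jacobian hτ) (hθ.comp u hτ)).differentiableAt (by simp)
    have h := fderiv_coMap_comp (X := frame n j) (u := u) (B := jacobian τ)
      (N := -∑ k, jacobian τ u k j • connMatrix g k (τ u)) (N' := connMatrix g' j u)
      (fun l m => (contDiffAt_jacobian hτ l m).of_le (by simp))
      (fun l m => by
        have e := connMatrix_transform hg hu hτ hJ hgg j
        rw [e, neg_mul, add_neg_cancel_comm]
        rfl) hτd hθd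
    rw [coordNabla_eq hpull, h, derivExt_coEnd_neg, fderiv_frame, add_sub_cancel_left]
    simp only [← map_smul, ← map_sum]
    congr 1
    simp only [coordNabla_eq hθd, smul_sub, Finset.sum_sub_distrib, map_sum, map_smul]
    rw [sub_eq_add_neg]
    congr 2
    -- Additivity and homogeneity in the matrix are extended to finite sums by induction.
    have : ∀ s : Finset (Fin n), derivExt (coEnd (∑ k ∈ s, jacobian τ u k j •
        connMatrix g k (τ u))) (θ (τ u)) =
        ∑ k ∈ s, jacobian τ u k j • derivExt (coEnd (connMatrix g k (τ u))) (θ (τ u)) := by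
      intro s
      induction s using Finset.induction_on with
      | empty =>
        rw [Finset.sum_empty, Finset.sum_empty, ← zero_smul ℝ (0 : Matrix (Fin n) (Fin n) ℝ),
          coEnd_smul, derivExt_smul, zero_smul]
      | insert a s ha ih =>
        rw [Finset.sum_insert ha, Finset.sum_insert ha, coEnd_add, derivExt_add, ih, coEnd_smul,
          derivExt_smul]
    exact this Finset.univ
  -- Two Jacobian factors, one from `∇` and one from the contraction, turn `g'⁻¹` into `g⁻¹`.
  have hinv := inv_transform hJ hgg.self_of_nhds
  simp only [coordDiv, hnabla, map_sum, map_smul, intProd_coMap, Finset.smul_sum, smul_smul]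
  rw [← hinv]
  simp only [Matrix.mul_apply, Matrix.transpose_apply, Finset.sum_mul, Finset.sum_smul]
  have e1 : ∀ F : Fin n → Fin n → Fin n → Fin n → CoordAlg n,
      ∑ i, ∑ j, ∑ k, ∑ l, F i j k l = ∑ l, ∑ k, ∑ j, ∑ i, F i j k l := by
    intro F
    calc ∑ i, ∑ j, ∑ k, ∑ l, F i j k l
        = ∑ j, ∑ i, ∑ k, ∑ l, F i j k l := Finset.sum_comm
      _ = ∑ j, ∑ k, ∑ i, ∑ l, F i j k l := Finset.sum_congr rfl fun j _ => Finset.sum_comm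
      _ = ∑ j, ∑ k, ∑ l, ∑ i, F i j k l :=
          Finset.sum_congr rfl fun j _ => Finset.sum_congr rfl fun k _ => Finset.sum_comm
      _ = ∑ k, ∑ j, ∑ l, ∑ i, F i j k l := Finset.sum_comm
      _ = ∑ k, ∑ l, ∑ j, ∑ i, F i j k l := Finset.sum_congr rfl fun k _ => Finset.sum_comm
      _ = ∑ l, ∑ k, ∑ j, ∑ i, F i j k l := Finset.sum_comm
  rw [e1]
  refine Finset.sum_congr rfl fun l _ => Finset.sum_congr rfl fun k _ =>
    Finset.sum_congr rfl fun j _ => Finset.sum_congr rfl fun i _ => ?_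
  congr 1
  ring

end ChangeOfCoordinates

/-! ### Charts -/

section Charts

variable {n : ℕ} {M : Type*} [TopologicalSpace M] [ChartedSpace (EuclideanSpace ℝ (Fin n)) M]

/-- The derivative of the inverse of a chart, with the tangent spaces read as `ℝⁿ`. -/
def chartDeriv (φ : OpenPartialHomeomorph M (EuclideanSpace ℝ (Fin n))) (u : Coord n) :
    Coord n →ₗ[ℝ] Coord n :=
  (mfderiv (𝓡 n) (𝓡 n) φ.symm u).toLinearMap

/-- A section of `Λ T*M`, with the tangent spaces read as `ℝⁿ`. -/
def flatForm (θ : RoughForm n M) : M → CoordAlg n := fun x => θ x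

/-- The matrix of a metric at a point, with the tangent spaces read as `ℝⁿ`. -/
def Metric.flatMatrix (g : Metric n M) (x : M) : Matrix (Fin n) (Fin n) ℝ :=
  Matrix.of fun i j => (g.val x : LinearMap.BilinForm ℝ (Coord n)) (frame n i) (frame n j)

/-- With all tangent spaces read as `ℝⁿ`, coordinate expressions are matrix actions and changes of
chart are matrix products. -/
theorem localForm_eq_coMap (φ : OpenPartialHomeomorph M (EuclideanSpace ℝ (Fin n)))
    (θ : RoughForm n M) (u : Coord n) :
    localForm φ θ u = coMap (linMatrix (chartDeriv φ u)) (flatForm θ (φ.symm u)) := by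
  rw [coMap, coEnd_linMatrix]
  rfl

theorem components_eq (g : Metric n M) (φ : OpenPartialHomeomorph M (EuclideanSpace ℝ (Fin n)))
    (u : Coord n) :
    g.components φ u = (linMatrix (chartDeriv φ u)).transpose * g.flatMatrix (φ.symm u) *
      linMatrix (chartDeriv φ u) := by
  have key : ∀ (B : LinearMap.BilinForm ℝ (Coord n)) (L : Coord n →ₗ[ℝ] Coord n) (i j : Fin n),
      B (L (frame n i)) (L (frame n j)) = ((linMatrix L).transpose *
        (Matrix.of fun i j => B (frame n i) (frame n j)) * linMatrix L) i j := by
    intro B L i j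
    conv_lhs => rw [← sum_coframe_smul_frame (L (frame n i)),
      ← sum_coframe_smul_frame (L (frame n j))]
    simp only [map_sum, map_smul, LinearMap.sum_apply, LinearMap.smul_apply, smul_eq_mul,
      Matrix.mul_apply, Matrix.transpose_apply, Matrix.of_apply, Finset.mul_sum, Finset.sum_mul]
    refine Finset.sum_congr rfl fun a _ => Finset.sum_congr rfl fun b _ => ?_
    simp only [linMatrix, Matrix.of_apply]
    ring
  ext i j
  exact key (g.val (φ.symm u)) (chartDeriv φ u) i j

variable {φ ψ : OpenPartialHomeomorph M (EuclideanSpace ℝ (Fin n))}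

theorem mdifferentiable_of_mem_maximalAtlas (hφ : φ ∈ IsManifold.maximalAtlas (𝓡 n) ∞ M) :
    φ.MDifferentiable (𝓡 n) (𝓡 n) :=
  ⟨(contMDiffOn_of_mem_maximalAtlas hφ).mdifferentiableOn (by simp),
    (contMDiffOn_symm_of_mem_maximalAtlas hφ).mdifferentiableOn (by simp)⟩

theorem isUnit_det_chartDeriv (hφ : φ ∈ IsManifold.maximalAtlas (𝓡 n) ∞ M) {u : Coord n}
    (hu : u ∈ φ.target) :
    IsUnit (linMatrix (chartDeriv φ u)).det := by
  have h := (mdifferentiable_of_mem_maximalAtlas hφ).comp_symm_deriv hu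
  have key : ∀ A B : Coord n →L[ℝ] Coord n, A.comp B = ContinuousLinearMap.id ℝ (Coord n) →
      IsUnit (linMatrix B.toLinearMap).det := fun A B hAB => by
    have h3 := congrArg (fun L : Coord n →L[ℝ] Coord n => (linMatrix L.toLinearMap).det) hAB
    have h4 : (linMatrix (A.toLinearMap ∘ₗ B.toLinearMap)).det =
        (linMatrix (LinearMap.id : Coord n →ₗ[ℝ] Coord n)).det := h3
    rw [linMatrix_comp, linMatrix_id, Matrix.det_mul, Matrix.det_one, mul_comm] at h4
    exact IsUnit.of_mul_eq_one _ h4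
  exact key _ _ h

/-- The coordinate vector fields `∂ᵢ` of a chart at a point. -/
def chartBasis (hφ : φ ∈ IsManifold.maximalAtlas (𝓡 n) ∞ M) {u : Coord n} (hu : u ∈ φ.target) :
    Module.Basis (Fin n) ℝ (TangentSpace (𝓡 n) (φ.symm u)) :=
  (frame n).map ((mdifferentiable_of_mem_maximalAtlas hφ).symm.mfderiv
    (show u ∈ φ.symm.source from hu)).toLinearEquiv

theorem chartBasis_apply (hφ : φ ∈ IsManifold.maximalAtlas (𝓡 n) ∞ M) {u : Coord n}
    (hu : u ∈ φ.target) (i : Fin n) :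
    chartBasis hφ hu i = mfderiv (𝓡 n) (𝓡 n) φ.symm u (frame n i) := rfl

theorem components_eq_toMatrix (hφ : φ ∈ IsManifold.maximalAtlas (𝓡 n) ∞ M) (g : Metric n M)
    {u : Coord n} (hu : u ∈ φ.target) :
    g.components φ u = LinearMap.BilinForm.toMatrix (chartBasis hφ hu) (g.val (φ.symm u)) := by
  ext i j
  rw [LinearMap.BilinForm.toMatrix_apply]
  rfl

theorem isLocalMetric_components (hφ : φ ∈ IsManifold.maximalAtlas (𝓡 n) ∞ M) (g : Metric n M) :
    IsLocalMetric (g.components φ) φ.target where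
  isOpen := φ.open_target
  smooth := g.smooth φ hφ
  symm u _ := by
    ext i j
    exact g.symm _ _ _
  det u hu := by
    rw [components_eq_toMatrix hφ g hu, isUnit_iff_ne_zero]
    exact (LinearMap.BilinForm.nondegenerate_iff_det_ne_zero _).1 (g.nondegenerate _)

theorem eventually_mem_transition {X : Type*} [TopologicalSpace X]
    {φ ψ : OpenPartialHomeomorph X (EuclideanSpace ℝ (Fin n))} {u : Coord n} (hu : u ∈ ψ.target)
    (hu' : ψ.symm u ∈ φ.source) : ∀ᶠ v in nhds u, v ∈ ψ.target ∧ ψ.symm v ∈ φ.source :=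
  (ψ.open_target.eventually_mem hu).and
    ((ψ.continuousAt_symm hu).eventually (φ.open_source.eventually_mem hu'))

theorem contDiffAt_transition (hφ : φ ∈ IsManifold.maximalAtlas (𝓡 n) ∞ M)
    (hψ : ψ ∈ IsManifold.maximalAtlas (𝓡 n) ∞ M) {u : Coord n} (hu : u ∈ ψ.target)
    (hu' : ψ.symm u ∈ φ.source) :
    ContDiffAt ℝ ∞ (fun v => φ (ψ.symm v)) u := by
  have h := (contMDiffAt_of_mem_maximalAtlas hφ hu').comp u
    (contMDiffAt_symm_of_mem_maximalAtlas hψ hu)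
  exact contMDiffAt_iff_contDiffAt.1 h

/-- The chain rule for `ψ⁻¹ = φ⁻¹ ∘ (φ ∘ ψ⁻¹)`, valid near `u`. -/
theorem chartDeriv_transition (hφ : φ ∈ IsManifold.maximalAtlas (𝓡 n) ∞ M)
    (hψ : ψ ∈ IsManifold.maximalAtlas (𝓡 n) ∞ M) {u : Coord n} (hu : u ∈ ψ.target)
    (hu' : ψ.symm u ∈ φ.source) :
    linMatrix (chartDeriv ψ u) = linMatrix (chartDeriv φ (φ (ψ.symm u))) *
      jacobian (fun v => φ (ψ.symm v)) u := by
  have hτ := (contDiffAt_transition hφ hψ hu hu').differentiableAt (by simp)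
  have hc : ψ.symm =ᶠ[nhds u] φ.symm ∘ fun v => φ (ψ.symm v) := by
    have : ψ.symm ⁻¹' φ.source ∈ nhds u :=
      (ψ.continuousAt_symm hu).preimage_mem_nhds (φ.open_source.mem_nhds hu')
    filter_upwards [this] with v hv
    exact (φ.left_inv hv).symm
  have h1 : MDifferentiableAt (𝓡 n) (𝓡 n) φ.symm (φ (ψ.symm u)) :=
    (contMDiffAt_symm_of_mem_maximalAtlas hφ (φ.map_source hu')).mdifferentiableAt (by simp)
  have h2 := mfderiv_comp (I := 𝓡 n) (I' := 𝓡 n) (I'' := 𝓡 n) u h1 hτ.mdifferentiableAt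
  have h3 := hc.mfderiv_eq (I := 𝓡 n) (I' := 𝓡 n)
  have key : ∀ A B B' C : Coord n →L[ℝ] Coord n, A = C.comp B → B = B' →
      linMatrix A.toLinearMap = linMatrix C.toLinearMap * linMatrix B'.toLinearMap := by
    rintro _ B _ C rfl rfl
    exact linMatrix_comp _ _
  exact key _ _ _ _ (h3.trans h2) mfderiv_eq_fderiv

theorem isUnit_det_jacobian_transition (hφ : φ ∈ IsManifold.maximalAtlas (𝓡 n) ∞ M)
    (hψ : ψ ∈ IsManifold.maximalAtlas (𝓡 n) ∞ M) {u : Coord n} (hu : u ∈ ψ.target)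
    (hu' : ψ.symm u ∈ φ.source) : IsUnit (jacobian (fun v => φ (ψ.symm v)) u).det := by
  have h := isUnit_det_chartDeriv hψ hu
  rw [chartDeriv_transition hφ hψ hu hu', Matrix.det_mul] at h
  exact isUnit_of_mul_isUnit_right h

theorem localForm_transition (hφ : φ ∈ IsManifold.maximalAtlas (𝓡 n) ∞ M)
    (hψ : ψ ∈ IsManifold.maximalAtlas (𝓡 n) ∞ M) (θ : RoughForm n M) {u : Coord n}
    (hu : u ∈ ψ.target)
    (hu' : ψ.symm u ∈ φ.source) :
    localForm ψ θ u = coMap (jacobian (fun v => φ (ψ.symm v)) u)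
      (localForm φ θ (φ (ψ.symm u))) := by
  rw [localForm_eq_coMap, localForm_eq_coMap, coMap_coMap, ← chartDeriv_transition hφ hψ hu hu',
    φ.left_inv hu']

theorem components_transition (hφ : φ ∈ IsManifold.maximalAtlas (𝓡 n) ∞ M)
    (hψ : ψ ∈ IsManifold.maximalAtlas (𝓡 n) ∞ M) (g : Metric n M) {u : Coord n} (hu : u ∈ ψ.target)
    (hu' : ψ.symm u ∈ φ.source) :
    g.components ψ u = (jacobian (fun v => φ (ψ.symm v)) u).transpose *
      g.components φ (φ (ψ.symm u)) * jacobian (fun v => φ (ψ.symm v)) u := by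
  rw [components_eq, components_eq, φ.left_inv hu', chartDeriv_transition hφ hψ hu hu',
    Matrix.transpose_mul]
  simp only [Matrix.mul_assoc]

theorem contDiffAt_localForm (hφ : φ ∈ IsManifold.maximalAtlas (𝓡 n) ∞ M) (θ : Forms n M)
    {u : Coord n} (hu : u ∈ φ.target) :
    ContDiffAt ℝ ∞ (localForm φ (θ : RoughForm n M)) u :=
  (contDiffOn_form_iff.2 (θ.2 φ hφ)).contDiffAt (φ.open_target.mem_nhds hu)

theorem coordDiv_transition (hφ : φ ∈ IsManifold.maximalAtlas (𝓡 n) ∞ M)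
    (hψ : ψ ∈ IsManifold.maximalAtlas (𝓡 n) ∞ M) (g : Metric n M) (θ : Forms n M) {u : Coord n}
    (hu : u ∈ ψ.target) (hu' : ψ.symm u ∈ φ.source) :
    coordDiv (g.components ψ) (localForm ψ (θ : RoughForm n M)) u =
      coMap (jacobian (fun v => φ (ψ.symm v)) u)
        (coordDiv (g.components φ) (localForm φ (θ : RoughForm n M)) (φ (ψ.symm u))) := by
  have hev := eventually_mem_transition hu hu'
  rw [← coordDiv_pullback (g' := g.components ψ) (isLocalMetric_components hφ g)
    (φ.map_source hu') (contDiffAt_transition hφ hψ hu hu')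
    (isUnit_det_jacobian_transition hφ hψ hu hu') ?_ (contDiffAt_localForm hφ θ (φ.map_source hu'))]
  · refine coordDiv_congr ?_
    filter_upwards [hev] with v hv
    exact localForm_transition hφ hψ _ hv.1 hv.2
  · filter_upwards [hev] with v hv
    exact components_transition hφ hψ g hv.1 hv.2

/-- The coordinate expression at a point, as an algebra homomorphism. -/
def localHom (φ : OpenPartialHomeomorph M (EuclideanSpace ℝ (Fin n))) (u : Coord n) :
    Forms n M →ₐ[ℝ] CoordAlg n :=
  ((ExteriorAlgebra.map
    (Module.Dual.transpose (R := ℝ) (M := Coord n) (M' := TangentSpace (𝓡 n) (φ.symm u))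
      (mfderiv (𝓡 n) (𝓡 n) φ.symm u).toLinearMap)).comp
    (Pi.evalAlgHom ℝ (fun x : M => ExteriorAlgebra ℝ (Cotangent n M x)) (φ.symm u))).comp
    (Forms n M).val

theorem localHom_apply (u : Coord n) (θ : Forms n M) :
    localHom φ u θ = localForm φ (θ : RoughForm n M) u := rfl

theorem coMap_inv_localForm (hφ : φ ∈ IsManifold.maximalAtlas (𝓡 n) ∞ M) (θ : RoughForm n M)
    {u : Coord n} (hu : u ∈ φ.target) :
    coMap (linMatrix (chartDeriv φ u))⁻¹ (localForm φ θ u) = flatForm θ (φ.symm u) := by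
  rw [localForm_eq_coMap, coMap_coMap, Matrix.mul_nonsing_inv _ (isUnit_det_chartDeriv hφ hu),
    coMap_one]

variable [IsManifold (𝓡 n) ∞ M]

theorem forms_ext {θ η : Forms n M}
    (h : ∀ φ ∈ IsManifold.maximalAtlas (𝓡 n) ∞ M, ∀ u ∈ φ.target, localHom φ u θ = localHom φ u η) :
    θ = η := by
  refine Subtype.ext (funext fun x => ?_)
  have hc := IsManifold.chart_mem_maximalAtlas (I := 𝓡 n) (n := ∞) (H := EuclideanSpace ℝ (Fin n)) x
  have hx := mem_chart_target (EuclideanSpace ℝ (Fin n)) x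
  have h1 := h _ hc _ hx
  rw [localHom_apply, localHom_apply] at h1
  have h2 := congrArg (coMap (linMatrix (chartDeriv (chartAt (EuclideanSpace ℝ (Fin n)) x)
    (chartAt (EuclideanSpace ℝ (Fin n)) x x)))⁻¹) h1
  rw [coMap_inv_localForm hc _ hx, coMap_inv_localForm hc _ hx,
    (chartAt (EuclideanSpace ℝ (Fin n)) x).left_inv (mem_chart_source _ x)] at h2
  exact h2

end Charts

/-! ### The codifferential of a metric -/

section Codifferential

variable {n : ℕ} {M : Type*} [TopologicalSpace M] [ChartedSpace (EuclideanSpace ℝ (Fin n)) M]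
  {φ : OpenPartialHomeomorph M (EuclideanSpace ℝ (Fin n))}

/-- The divergence of a form at a point, computed in the preferred chart. -/
def divAt (g : Metric n M) (θ : Forms n M) (x : M) : CoordAlg n :=
  coMap (linMatrix (chartDeriv (chartAt (EuclideanSpace ℝ (Fin n)) x)
      (chartAt (EuclideanSpace ℝ (Fin n)) x x)))⁻¹
    (coordDiv (g.components (chartAt (EuclideanSpace ℝ (Fin n)) x))
      (localForm (chartAt (EuclideanSpace ℝ (Fin n)) x) (θ : RoughForm n M))
      (chartAt (EuclideanSpace ℝ (Fin n)) x x))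

/-- The divergence of a form. -/
def roughDiv (g : Metric n M) (θ : Forms n M) : RoughForm n M := fun x => divAt g θ x

theorem differentiableAt_localHom (hφ : φ ∈ IsManifold.maximalAtlas (𝓡 n) ∞ M) (θ : Forms n M)
    {u : Coord n} (hu : u ∈ φ.target) : DifferentiableAt ℝ (fun v => localHom φ v θ) u :=
  (contDiffAt_localForm hφ θ hu).differentiableAt (by simp)

theorem localHom_mem {p : ℕ} {θ : Forms n M} (hθ : θ ∈ formsOfDegree n M p) (u : Coord n) :
    localHom φ u θ ∈ ⋀[ℝ]^p (Module.Dual ℝ (Coord n)) :=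
  map_mem_exteriorPower _ (hθ _)

theorem localHom_ofFun (a : C^∞⟮𝓡 n, M; ℝ⟯) (u : Coord n) :
    localHom φ u (ofFun a) = algebraMap ℝ _ (a (φ.symm u)) :=
  AlgHom.commutes _ _

theorem IsCodifferential.localHom_eq {g : Metric n M} {δ : Forms n M →ₗ[ℝ] Forms n M}
    (h : IsCodifferential g δ) (hφ : φ ∈ IsManifold.maximalAtlas (𝓡 n) ∞ M)
    (θ : Forms n M) {u : Coord n} (hu : u ∈ φ.target) :
    localHom φ u (δ θ) = coordDiv (g.components φ) (fun v => localHom φ v θ) u :=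
  h φ hφ θ u hu

variable [IsManifold (𝓡 n) ∞ M]

theorem chartAt_mem_maximalAtlas (x : M) :
    chartAt (EuclideanSpace ℝ (Fin n)) x ∈ IsManifold.maximalAtlas (𝓡 n) ∞ M :=
  IsManifold.chart_mem_maximalAtlas x

/-- `divAt` uses a chart that varies with the point; comparing `φ` with the preferred chart of each
point shows that the choice does not matter. -/
theorem localForm_roughDiv (hφ : φ ∈ IsManifold.maximalAtlas (𝓡 n) ∞ M) (g : Metric n M)
    (θ : Forms n M) {u : Coord n} (hu : u ∈ φ.target) :
    localForm φ (roughDiv g θ) u =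
      coordDiv (g.components φ) (localForm φ (θ : RoughForm n M)) u := by
  have hc := chartAt_mem_maximalAtlas (n := n) (φ.symm u)
  have hx := mem_chart_source (EuclideanSpace ℝ (Fin n)) (φ.symm u)
  have hx' := mem_chart_target (EuclideanSpace ℝ (Fin n)) (φ.symm u)
  rw [localForm_eq_coMap, coordDiv_transition hc hφ g θ hu hx]
  have h : flatForm (roughDiv g θ) (φ.symm u) = divAt g θ (φ.symm u) := rfl
  rw [h, divAt, coMap_coMap, chartDeriv_transition hc hφ hu hx, ← Matrix.mul_assoc,
    Matrix.nonsing_inv_mul _ (isUnit_det_chartDeriv hc hx'), Matrix.one_mul]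

theorem isSmoothForm_roughDiv (g : Metric n M) (θ : Forms n M) : IsSmoothForm (roughDiv g θ) := by
  intro φ hφ
  refine contDiffOn_form_iff.1 fun u hu => ContDiffAt.contDiffWithinAt ?_
  refine (contDiffAt_coordDiv (isLocalMetric_components hφ g) hu
    (contDiffAt_localForm hφ θ hu)).congr_of_eventuallyEq ?_
  filter_upwards [φ.open_target.mem_nhds hu] with v hv
  exact localForm_roughDiv hφ g θ hv

theorem localHom_roughDiv (hφ : φ ∈ IsManifold.maximalAtlas (𝓡 n) ∞ M) (g : Metric n M)
    (θ : Forms n M) {u : Coord n} (hu : u ∈ φ.target) :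
    localHom φ u ⟨roughDiv g θ, isSmoothForm_roughDiv g θ⟩ =
      coordDiv (g.components φ) (fun v => localHom φ v θ) u :=
  localForm_roughDiv hφ g θ hu

/-- The codifferential of a metric. -/
def codiff (g : Metric n M) : Forms n M →ₗ[ℝ] Forms n M where
  toFun θ := ⟨roughDiv g θ, isSmoothForm_roughDiv g θ⟩
  map_add' θ η := by
    refine forms_ext fun φ hφ u hu => ?_
    rw [map_add, localHom_roughDiv hφ g _ hu, localHom_roughDiv hφ g _ hu,
      localHom_roughDiv hφ g _ hu, ← coordDiv_add (differentiableAt_localHom hφ θ hu)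
        (differentiableAt_localHom hφ η hu)]
    simp only [map_add]
  map_smul' r θ := by
    refine forms_ext fun φ hφ u hu => ?_
    have h := coordDiv_smul (g := g.components φ) (differentiableAt_localHom hφ θ hu)
      (a := fun _ => r) (differentiableAt_const _)
    simp only [pderiv, fderiv_fun_const, Pi.zero_apply, zero_apply, mul_zero, zero_smul,
      Finset.sum_const_zero, add_zero] at h
    rw [RingHom.id_apply, map_smul, localHom_roughDiv hφ g _ hu, localHom_roughDiv hφ g _ hu, ← h]
    simp only [map_smul]

theorem isCodifferential_codiff (g : Metric n M) : IsCodifferential g (codiff g) :=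
  fun _ hφ θ _ hu => localForm_roughDiv hφ g θ hu

namespace IsCodifferential

variable {g : Metric n M} {δ : Forms n M →ₗ[ℝ] Forms n M}

theorem unique {δ' : Forms n M →ₗ[ℝ] Forms n M} (h : IsCodifferential g δ)
    (h' : IsCodifferential g δ') : δ = δ' :=
  LinearMap.ext fun θ => forms_ext fun φ hφ u hu => by
    rw [h.localHom_eq hφ θ hu, h'.localHom_eq hφ θ hu]

theorem isBV (h : IsCodifferential g δ) : IsBV δ where
  degree_zero θ hθ := forms_ext fun φ hφ u hu => by
    rw [h.localHom_eq hφ θ hu, map_zero]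
    exact coordDiv_eq_zero (differentiableAt_localHom hφ θ hu)
      (Filter.Eventually.of_forall fun v => localHom_mem hθ v)
  -- Degree is a membership, not an equation, so it is carried from the chart back to the cotangent
  -- space by the inverse matrix.
  degree_succ k θ hθ x := by
    have hc := chartAt_mem_maximalAtlas (n := n) x
    have hx := mem_chart_target (EuclideanSpace ℝ (Fin n)) x
    have h1 : localHom (chartAt (EuclideanSpace ℝ (Fin n)) x)
        (chartAt (EuclideanSpace ℝ (Fin n)) x x) (δ θ) ∈ ⋀[ℝ]^k (Module.Dual ℝ (Coord n)) := by
      rw [h.localHom_eq hc θ hx]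
      exact coordDiv_mem (differentiableAt_localHom hc θ hx)
        (Filter.Eventually.of_forall fun v => localHom_mem hθ v)
    have h2 := map_mem_exteriorPower (coEnd (linMatrix (chartDeriv
      (chartAt (EuclideanSpace ℝ (Fin n)) x) (chartAt (EuclideanSpace ℝ (Fin n)) x x)))⁻¹) h1
    rw [localHom_apply] at h2
    erw [coMap_inv_localForm hc _ hx] at h2
    rw [(chartAt (EuclideanSpace ℝ (Fin n)) x).left_inv (mem_chart_source _ x)] at h2
    exact h2
  sq_zero θ := forms_ext fun φ hφ u hu => by
    rw [h.localHom_eq hφ _ hu, map_zero]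
    rw [coordDiv_congr (η := coordDiv (g.components φ) (fun v => localHom φ v θ))]
    · exact coordDiv_coordDiv (isLocalMetric_components hφ g) hu
        (fun v hv => (contDiffAt_localForm hφ θ hv).contDiffWithinAt)
    · filter_upwards [φ.open_target.mem_nhds hu] with v hv
      exact h.localHom_eq hφ θ hv
  seven_term p q θ hθ η hη ζ := forms_ext fun φ hφ u hu => by
    simp only [map_mul, map_add, map_sub, map_pow, map_neg, map_one, h.localHom_eq hφ _ hu]
    exact coordDiv_seven_term (differentiableAt_localHom hφ θ hu)
      (differentiableAt_localHom hφ η hu) (differentiableAt_localHom hφ ζ hu)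
      (Filter.Eventually.of_forall fun v => localHom_mem hθ v)
      (Filter.Eventually.of_forall fun v => localHom_mem hη v)

end IsCodifferential

end Codifferential

/-! ### Inverse bilinear forms -/

section InverseForm

variable {n : ℕ} {V : Type*} [AddCommGroup V] [Module ℝ V] [FiniteDimensional ℝ V]

theorem toDual_symm_pairing {B : LinearMap.BilinForm ℝ V} (hB : B.Nondegenerate)
    (α β : Module.Dual ℝ V) :
    B ((B.toDual hB).symm α) ((B.toDual hB).symm β) = α ((B.toDual hB).symm β) :=
  LinearMap.BilinForm.apply_toDual_symm_apply α _

/-- The inverse form in a basis. -/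
theorem toDual_symm_pairing_eq_sum {B : LinearMap.BilinForm ℝ V} (hB : B.Nondegenerate)
    (hs : ∀ v w, B v w = B w v) (b : Module.Basis (Fin n) ℝ V) (α β : Module.Dual ℝ V) :
    B ((B.toDual hB).symm α) ((B.toDual hB).symm β) =
      ∑ i, ∑ j, (LinearMap.BilinForm.toMatrix b B)⁻¹ i j * (α (b i) * β (b j)) := by
  rw [toDual_symm_pairing]
  set w := (B.toDual hB).symm β with hw
  set G := LinearMap.BilinForm.toMatrix b B with hG
  have hdet : IsUnit G.det := by
    rw [isUnit_iff_ne_zero]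
    exact (LinearMap.BilinForm.nondegenerate_iff_det_ne_zero b).1 hB
  have hβ : (fun j => β (b j)) = G.mulVec (b.repr w) := by
    funext j
    have h1 : β (b j) = B (b j) w := by
      rw [hs, hw, LinearMap.BilinForm.apply_toDual_symm_apply]
    rw [h1]
    conv_lhs => rw [← b.sum_repr w]
    simp only [map_sum, map_smul, smul_eq_mul, Matrix.mulVec, dotProduct, hG,
      LinearMap.BilinForm.toMatrix_apply]
    exact Finset.sum_congr rfl fun i _ => mul_comm _ _
  have h2 : ∀ i, ∑ j, G⁻¹ i j * β (b j) = b.repr w i := by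
    intro i
    have h3 : G⁻¹.mulVec (fun j => β (b j)) = b.repr w := by
      rw [hβ, Matrix.mulVec_mulVec, Matrix.nonsing_inv_mul _ hdet, Matrix.one_mulVec]
    exact congrFun h3 i
  conv_lhs => rw [← b.sum_repr w]
  rw [map_sum]
  refine Finset.sum_congr rfl fun i _ => ?_
  rw [map_smul, smul_eq_mul, ← h2, Finset.sum_mul]
  exact Finset.sum_congr rfl fun j _ => by ring

/-- A nondegenerate symmetric form on the dual space is inverse to a form on the space. -/
theorem exists_inverse_form (h : Module.Dual ℝ V →ₗ[ℝ] Module.Dual ℝ V →ₗ[ℝ] ℝ)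
    (hs : ∀ α β, h α β = h β α) (hinj : Function.Injective h) :
    ∃ (B : LinearMap.BilinForm ℝ V) (hB : B.Nondegenerate), (∀ v w, B v w = B w v) ∧
      ∀ α β, B ((B.toDual hB).symm α) ((B.toDual hB).symm β) = h α β := by
  -- A form on the dual space is a map `V* → V** ≅ V`: the operation `♯`. Injectivity and equal
  -- dimensions make it invertible, and its inverse is the form on `V`.
  let S₀ : Module.Dual ℝ V →ₗ[ℝ] V := (Module.evalEquiv ℝ V).symm.toLinearMap ∘ₗ h
  have hS₀ : Function.Injective S₀ := (Module.evalEquiv ℝ V).symm.injective.comp hinj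
  let S : Module.Dual ℝ V ≃ₗ[ℝ] V :=
    LinearMap.linearEquivOfInjective S₀ hS₀ Subspace.dual_finrank_eq
  have hS : ∀ α β, β (S α) = h α β := fun α β => by
    have h1 : Module.evalEquiv ℝ V (S α) = h α :=
      (Module.evalEquiv ℝ V).apply_symm_apply (h α)
    rw [← h1]
    rfl
  let B : LinearMap.BilinForm ℝ V := S.symm.toLinearMap
  have hBS : ∀ α β, B (S α) (S β) = h α β := fun α β => by
    change S.symm (S α) (S β) = _
    rw [S.symm_apply_apply, hS, hs]
  have hsymm : ∀ v w, B v w = B w v := fun v w => by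
    obtain ⟨α, rfl⟩ := S.surjective v
    obtain ⟨β, rfl⟩ := S.surjective w
    rw [hBS, hBS, hs]
  have hleft : B.SeparatingLeft := fun v hv =>
    S.symm.map_eq_zero_iff.1 (LinearMap.ext hv)
  have hB : B.Nondegenerate := ⟨hleft, fun w hw => hleft w fun v => by rw [hsymm, hw]⟩
  refine ⟨B, hB, hsymm, fun α β => ?_⟩
  have e : ∀ α, (B.toDual hB).symm α = S α := fun α => by
    rw [LinearEquiv.symm_apply_eq]
    refine LinearMap.ext fun w => ?_
    rw [LinearMap.BilinForm.toDual_def]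
    exact congrArg (fun γ : Module.Dual ℝ V => γ w) (S.symm_apply_apply α).symm
  rw [e, e, hBS]

end InverseForm

/-! ### The inverse metric on covectors -/

namespace Metric

variable {n : ℕ} {M : Type*} [TopologicalSpace M] [ChartedSpace (EuclideanSpace ℝ (Fin n)) M]

theorem inv_symm (g : Metric n M) (x : M) (α β : Cotangent n M x) :
    g.inv x α β = g.inv x β α := g.symm _ _ _

theorem eq_zero_of_inv (g : Metric n M) {x : M} {α : Cotangent n M x}
    (h : ∀ β, g.inv x α β = 0) : α = 0 := by
  refine LinearMap.ext fun w => ?_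
  have h1 := h ((g.val x).toDual (g.nondegenerate x) w)
  rw [inv, toDual_symm_pairing, LinearEquiv.symm_apply_apply] at h1
  exact h1

theorem inv_toDual (g : Metric n M) (x : M) (v w : TangentSpace (𝓡 n) x) :
    g.inv x ((g.val x).toDual (g.nondegenerate x) v) ((g.val x).toDual (g.nondegenerate x) w) =
      g.val x v w := by
  rw [inv, LinearEquiv.symm_apply_apply, LinearEquiv.symm_apply_apply]

theorem ext_of_inv {g g' : Metric n M} (h : ∀ x α β, g.inv x α β = g'.inv x α β) : g = g' := by
  refine Metric.ext (funext fun x => ?_)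
  have h1 : ∀ β, ((g.val x).toDual (g.nondegenerate x)).symm β =
      ((g'.val x).toDual (g'.nondegenerate x)).symm β := fun β => by
    refine sub_eq_zero.1 ((Module.forall_dual_apply_eq_zero_iff ℝ _).1 fun α => ?_)
    have h2 := h x α β
    rw [inv, inv, toDual_symm_pairing, toDual_symm_pairing] at h2
    rw [map_sub, h2, sub_self]
  refine LinearMap.ext fun v => ?_
  have h3 := h1 ((g.val x).toDual (g.nondegenerate x) v)
  rw [LinearEquiv.symm_apply_apply, eq_comm, LinearEquiv.symm_apply_eq] at h3
  refine LinearMap.ext fun w => ?_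
  have h4 := congrArg (fun γ : Cotangent n M x => γ w) h3
  simpa only [LinearMap.BilinForm.toDual_def] using h4

end Metric

/-! ### Functions and forms near a point -/

section LocalToGlobal

variable {n : ℕ} {M : Type*} [TopologicalSpace M] [ChartedSpace (EuclideanSpace ℝ (Fin n)) M]

/-- Every germ of a smooth function is the germ of a global one: multiply by a bump function whose
closed support lies in `U`. -/
theorem exists_smooth_eventuallyEq [IsManifold (𝓡 n) ∞ M] [T2Space M] {U : Set M} (hU : IsOpen U)
    {x : M} (hx : x ∈ U) {f : M → ℝ} (hf : ContMDiffOn (𝓡 n) 𝓘(ℝ, ℝ) ∞ f U) :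
    ∃ a : C^∞⟮𝓡 n, M; ℝ⟯, (a : M → ℝ) =ᶠ[nhds x] f := by
  obtain ⟨χ, -, hχ⟩ := (SmoothBumpFunction.nhds_basis_tsupport (I := 𝓡 n) x).mem_iff.1
    (hU.mem_nhds hx)
  refine ⟨⟨fun y => χ y * f y, contMDiff_of_tsupport fun y hy => ?_⟩, ?_⟩
  · have hyU : y ∈ U := hχ (closure_mono (Function.support_mul_subset_left _ _) hy)
    exact χ.contMDiffAt.mul (hf.contMDiffAt (hU.mem_nhds hyU))
  · filter_upwards [χ.eventuallyEq_one] with y hy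
    change χ y * f y = f y
    rw [hy, Pi.one_apply, one_mul]

theorem exists_smooth_cutoff [IsManifold (𝓡 n) ∞ M] [T2Space M] {U : Set M} {x : M}
    (hU : U ∈ nhds x) : ∃ χ : C^∞⟮𝓡 n, M; ℝ⟯, χ x = 1 ∧ ∀ y ∉ U, χ y = 0 := by
  obtain ⟨χ, -, hχ⟩ := (SmoothBumpFunction.nhds_basis_tsupport (I := 𝓡 n) x).mem_iff.1 hU
  exact ⟨⟨χ, χ.contMDiff⟩, χ.eq_one, fun y hy => image_eq_zero_of_notMem_tsupport
    (fun h => hy (hχ h))⟩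

theorem exists_chart_point [IsManifold (𝓡 n) ∞ M] (x : M) :
    ∃ φ ∈ IsManifold.maximalAtlas (𝓡 n) ∞ M, ∃ u ∈ φ.target, φ.symm u = x :=
  ⟨chartAt (EuclideanSpace ℝ (Fin n)) x, chartAt_mem_maximalAtlas x, _, mem_chart_target _ x,
    (chartAt (EuclideanSpace ℝ (Fin n)) x).left_inv (mem_chart_source _ x)⟩

variable {φ : OpenPartialHomeomorph M (EuclideanSpace ℝ (Fin n))}

theorem dAt_mfderiv (hφ : φ ∈ IsManifold.maximalAtlas (𝓡 n) ∞ M) (a : C^∞⟮𝓡 n, M; ℝ⟯)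
    {u : Coord n} (hu : u ∈ φ.target) (X : Coord n) :
    dAt a (φ.symm u) (mfderiv (𝓡 n) (𝓡 n) φ.symm u X) = fderiv ℝ (fun v => a (φ.symm v)) u X := by
  have h1 : MDifferentiableAt (𝓡 n) 𝓘(ℝ, ℝ) a (φ.symm u) :=
    a.contMDiff.mdifferentiable (by simp) _
  have h2 : MDifferentiableAt (𝓡 n) (𝓡 n) φ.symm u :=
    (contMDiffAt_symm_of_mem_maximalAtlas hφ hu).mdifferentiableAt (by simp)
  have h3 : fderiv ℝ (fun u => a (φ.symm u)) u =
      (mfderiv (𝓡 n) 𝓘(ℝ, ℝ) a (φ.symm u)).comp (mfderiv (𝓡 n) (𝓡 n) φ.symm u) := by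
    rw [← mfderiv_eq_fderiv]
    exact mfderiv_comp u h1 h2
  rw [h3]
  rfl

theorem localHom_of_eq_ι {θ : Forms n M} {u : Coord n} {α : Cotangent n M (φ.symm u)}
    (h : (θ : RoughForm n M) (φ.symm u) = ExteriorAlgebra.ι ℝ α) :
    localHom φ u θ = ExteriorAlgebra.ι ℝ (Module.Dual.transpose (R := ℝ) (M := Coord n)
      (M' := TangentSpace (𝓡 n) (φ.symm u)) (mfderiv (𝓡 n) (𝓡 n) φ.symm u).toLinearMap α) := by
  rw [localHom_apply, localForm, h, ExteriorAlgebra.map_apply_ι]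

theorem algebraMapInv_localHom (η : Forms n M) (u : Coord n) :
    ExteriorAlgebra.algebraMapInv (localHom φ u η) =
      ExteriorAlgebra.algebraMapInv ((η : RoughForm n M) (φ.symm u)) :=
  algebraMapInv_map _ _

theorem exists_eq_ι {θ : Forms n M} (hθ : θ ∈ formsOfDegree n M 1) (x : M) :
    ∃ α : Cotangent n M x, (θ : RoughForm n M) x = ExteriorAlgebra.ι ℝ α := by
  have h := hθ x
  change _ ∈ LinearMap.range (ExteriorAlgebra.ι ℝ) ^ 1 at h
  rw [pow_one] at h
  obtain ⟨α, hα⟩ := h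
  exact ⟨α, hα.symm⟩

theorem dFun_mem (a : C^∞⟮𝓡 n, M; ℝ⟯) : dFun a ∈ formsOfDegree n M 1 := fun x => by
  change ExteriorAlgebra.ι ℝ (dAt a x) ∈ LinearMap.range (ExteriorAlgebra.ι ℝ) ^ 1
  rw [pow_one]
  exact ⟨_, rfl⟩

theorem ofFun_mem (a : C^∞⟮𝓡 n, M; ℝ⟯) : ofFun a ∈ formsOfDegree n M 0 := fun x => by
  change algebraMap ℝ _ (a x) ∈ LinearMap.range (ExteriorAlgebra.ι ℝ) ^ 0
  rw [pow_zero]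
  exact Submodule.mem_one.2 ⟨_, rfl⟩

theorem mul_mem_formsOfDegree {p q : ℕ} {θ η : Forms n M} (hθ : θ ∈ formsOfDegree n M p)
    (hη : η ∈ formsOfDegree n M q) : θ * η ∈ formsOfDegree n M (p + q) := fun x =>
  SetLike.mul_mem_graded (A := fun i : ℕ => ⋀[ℝ]^i (Cotangent n M x)) (hθ x) (hη x)

theorem eventuallyEq_comp_symm {X : Type*} [TopologicalSpace X]
    {φ : OpenPartialHomeomorph X (EuclideanSpace ℝ (Fin n))} {u : Coord n} (hu : u ∈ φ.target) {a f : X → ℝ}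
    (h : a =ᶠ[nhds (φ.symm u)] f) :
    (fun v => a (φ.symm v)) =ᶠ[nhds u] fun v => f (φ.symm v) :=
  (φ.continuousAt_symm hu).eventually h

/-- The function extends `α ∘ φ`. Its differential is prescribed on a whole neighbourhood, as local
coframes and the smoothness of the metric require. -/
theorem exists_coordinate [IsManifold (𝓡 n) ∞ M] [T2Space M]
    (hφ : φ ∈ IsManifold.maximalAtlas (𝓡 n) ∞ M) {u : Coord n} (hu : u ∈ φ.target)
    (α : Module.Dual ℝ (Coord n)) :
    ∃ a : C^∞⟮𝓡 n, M; ℝ⟯, ∀ᶠ v in nhds u, ∀ X : Coord n,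
      dAt a (φ.symm v) (mfderiv (𝓡 n) (𝓡 n) φ.symm v X) = α X := by
  have hs : ContMDiffOn (𝓡 n) 𝓘(ℝ, ℝ) ∞ (fun x => α (φ x)) φ.source :=
    (LinearMap.toContinuousLinearMap α).contMDiff.comp_contMDiffOn
      (contMDiffOn_of_mem_maximalAtlas hφ)
  obtain ⟨a, ha⟩ := exists_smooth_eventuallyEq φ.open_source (φ.map_target hu) hs
  refine ⟨a, ?_⟩
  have h1 : (fun v => a (φ.symm v)) =ᶠ[nhds u] fun v => LinearMap.toContinuousLinearMap α v := by
    filter_upwards [eventuallyEq_comp_symm hu ha, φ.open_target.mem_nhds hu] with v hv hv'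
    rw [hv, φ.right_inv hv']
    rfl
  filter_upwards [h1.eventuallyEq_nhds, φ.open_target.mem_nhds hu] with v hv hv' X
  refine (dAt_mfderiv hφ a hv' X).trans ?_
  rw [hv.fderiv_eq, ContinuousLinearMap.fderiv]
  rfl

theorem exists_dAt_eq [IsManifold (𝓡 n) ∞ M] [T2Space M] (x : M) (α : Cotangent n M x) :
    ∃ a : C^∞⟮𝓡 n, M; ℝ⟯, dAt a x = α := by
  obtain ⟨φ, hφ, u, hu, rfl⟩ := exists_chart_point (n := n) x
  obtain ⟨a, ha⟩ := exists_coordinate hφ hu (Module.Dual.transpose (R := ℝ) (M := Coord n)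
      (M' := TangentSpace (𝓡 n) (φ.symm u)) (mfderiv (𝓡 n) (𝓡 n) φ.symm u).toLinearMap α)
  refine ⟨a, (chartBasis hφ hu).ext fun i => ?_⟩
  rw [chartBasis_apply]
  exact ha.self_of_nhds (frame n i)

end LocalToGlobal

/-! ### The associated bilinear form -/

section Pairing

variable {n : ℕ} {M : Type*} [TopologicalSpace M] [ChartedSpace (EuclideanSpace ℝ (Fin n)) M]
  {δ : Forms n M →ₗ[ℝ] Forms n M} {g : Metric n M}

theorem algebraMapInv_algebraMap {V : Type*} [AddCommGroup V] [Module ℝ V] (r : ℝ) :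
    ExteriorAlgebra.algebraMapInv (algebraMap ℝ (ExteriorAlgebra ℝ V) r) = r :=
  ExteriorAlgebra.algebraMap_leftInverse V r

/-- The associated form as a linear map of the first argument. -/
def pairingLin (δ : Forms n M →ₗ[ℝ] Forms n M) (a : C^∞⟮𝓡 n, M; ℝ⟯) (x : M) :
    Forms n M →ₗ[ℝ] ℝ :=
  ExteriorAlgebra.algebraMapInv.toLinearMap ∘ₗ
    (Pi.evalAlgHom ℝ (fun x : M => ExteriorAlgebra ℝ (Cotangent n M x)) x).toLinearMap ∘ₗ
    (Forms n M).val.toLinearMap ∘ₗ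
    (δ ∘ₗ LinearMap.mulLeft ℝ (ofFun a) - LinearMap.mulLeft ℝ (ofFun a) ∘ₗ δ)

theorem pairing_add (θ η : Forms n M) (a : C^∞⟮𝓡 n, M; ℝ⟯) (x : M) :
    pairing δ (θ + η) a x = pairing δ θ a x + pairing δ η a x :=
  map_add (pairingLin δ a x) θ η

theorem pairing_smul (r : ℝ) (θ : Forms n M) (a : C^∞⟮𝓡 n, M; ℝ⟯) (x : M) :
    pairing δ (r • θ) a x = r * pairing δ θ a x :=
  map_smul (pairingLin δ a x) r θ

theorem pairing_sum {ι : Type*} (s : Finset ι) (θ : ι → Forms n M) (a : C^∞⟮𝓡 n, M; ℝ⟯) (x : M) :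
    pairing δ (∑ i ∈ s, θ i) a x = ∑ i ∈ s, pairing δ (θ i) a x :=
  map_sum (pairingLin δ a x) θ s

theorem pairing_symm (hs : IsSymmetricOp δ) (a b : C^∞⟮𝓡 n, M; ℝ⟯) (x : M) :
    pairing δ (dFun b) a x = pairing δ (dFun a) b x := by
  rw [pairing, pairing, hs]

/-- The 7-term identity for two functions, with the exponents at `p = q = 0`. As `δ` kills
functions, it says that `δ(a ·) - a δ` commutes with multiplication by `b`. -/
theorem sub_eq_mul_sub_of_seven_term {R : Type*} [Ring R] {a b z A B D X da db dab : R}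
    (h : X = dab * z + (-1) ^ 0 * (a * B) + (-1) ^ ((0 + 1) * 0) * (b * A) - da * b * z
      - (-1) ^ 0 * (a * db * z) - (-1) ^ (0 + 0) * (a * b * D)) (hda : da = 0) (hdb : db = 0)
    (hdab : dab = 0) (hc : a * b = b * a) : X - a * B = b * (A - a * D) := by
  rw [h, hc, hda, hdb, hdab]
  simp only [zero_mul, mul_zero, pow_zero, one_mul, add_zero]
  noncomm_ring

/-- The associated form is linear over functions. -/
theorem pairing_ofFun_mul (h : IsBV δ) (b : C^∞⟮𝓡 n, M; ℝ⟯) (θ : Forms n M)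
    (a : C^∞⟮𝓡 n, M; ℝ⟯) (x : M) :
    pairing δ (ofFun b * θ) a x = b x * pairing δ θ a x := by
  have h7 := h.seven_term 0 0 (ofFun a) (ofFun_mem a) (ofFun b) (ofFun_mem b) θ
  have hc : ofFun a * ofFun b = ofFun b * ofFun a :=
    Subtype.ext (funext fun x =>
      Algebra.commutes (A := ExteriorAlgebra ℝ (Cotangent n M x)) (a x) (algebraMap ℝ _ (b x)))
  have e := sub_eq_mul_sub_of_seven_term h7 (h.degree_zero _ (ofFun_mem a))
    (h.degree_zero _ (ofFun_mem b))
    (h.degree_zero _ (mul_mem_formsOfDegree (ofFun_mem a) (ofFun_mem b))) hc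
  have e' : δ (ofFun a * (ofFun b * θ)) - ofFun a * δ (ofFun b * θ) =
      ofFun b * (δ (ofFun a * θ) - ofFun a * δ θ) :=
    (congrArg (fun η => δ η - ofFun a * δ (ofFun b * θ))
      (mul_assoc (ofFun a) (ofFun b) θ).symm).trans e
  have e2 := congrArg
    (fun η : Forms n M => ExteriorAlgebra.algebraMapInv ((η : RoughForm n M) x)) e'
  refine Eq.trans e2 ?_
  change ExteriorAlgebra.algebraMapInv (algebraMap ℝ (ExteriorAlgebra ℝ (Cotangent n M x)) (b x) *
    ((δ (ofFun a * θ) - ofFun a * δ θ : Forms n M) : RoughForm n M) x) = _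
  rw [map_mul, algebraMapInv_algebraMap]
  rfl

theorem IsInverseMetricOf.pairing_dFun (h : IsInverseMetricOf δ g) (a b : C^∞⟮𝓡 n, M; ℝ⟯) (x : M) :
    pairing δ (dFun b) a x = g.inv x (dAt b x) (dAt a x) := by
  rw [h _ (dFun_mem b) a x]
  congr 1
  exact ExteriorAlgebra.ι_leftInverse (R := ℝ) (dAt b x)

theorem ι_ιInv {θ : Forms n M} (hθ : θ ∈ formsOfDegree n M 1) (x : M) :
    ExteriorAlgebra.ι ℝ (ExteriorAlgebra.ιInv ((θ : RoughForm n M) x)) =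
      (θ : RoughForm n M) x := by
  obtain ⟨α, hα⟩ := exists_eq_ι hθ x
  rw [hα, ExteriorAlgebra.ι_leftInverse]

/-- Both sides of the symmetry condition have degree `0`, so `algebraMapInv` loses nothing and the
condition becomes symmetry of the inverse metric. -/
theorem isSymmetricOp_of_inverse (hBV : IsBV δ) (h : IsInverseMetricOf δ g) :
    IsSymmetricOp δ := by
  intro a b
  have hdeg : ∀ a b : C^∞⟮𝓡 n, M; ℝ⟯,
      δ (ofFun a * dFun b) - ofFun a * δ (dFun b) ∈ formsOfDegree n M 0 := fun a b => by
    refine Submodule.sub_mem _ (hBV.degree_succ 0 _ ?_) ?_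
    · exact mul_mem_formsOfDegree (ofFun_mem a) (dFun_mem b)
    · exact mul_mem_formsOfDegree (ofFun_mem a) (hBV.degree_succ 0 _ (dFun_mem b))
  have hval : ∀ (η : Forms n M), η ∈ formsOfDegree n M 0 → ∀ x, (η : RoughForm n M) x =
      algebraMap ℝ _ (ExteriorAlgebra.algebraMapInv ((η : RoughForm n M) x)) := fun η hη x => by
    have h1 := hη x
    change _ ∈ LinearMap.range (ExteriorAlgebra.ι ℝ) ^ 0 at h1
    rw [pow_zero] at h1
    obtain ⟨r, hr⟩ := Submodule.mem_one.1 h1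
    rw [← hr, algebraMapInv_algebraMap]
  refine Subtype.ext (funext fun x => ?_)
  rw [hval _ (hdeg a b), hval _ (hdeg b a)]
  congr 1
  change pairing δ (dFun b) a x = pairing δ (dFun a) b x
  rw [h.pairing_dFun, h.pairing_dFun, g.inv_symm]

variable [IsManifold (𝓡 n) ∞ M]

/-- The gradient term of `coordDiv_smul`, compared with the inverse metric written in the basis `∂ᵢ`
of a chart. -/
theorem IsCodifferential.isInverseMetricOf (h : IsCodifferential g δ) : IsInverseMetricOf δ g := by
  intro θ hθ a x
  obtain ⟨φ, hφ, u, hu, rfl⟩ := exists_chart_point (n := n) x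
  obtain ⟨α, hα⟩ := exists_eq_ι hθ (φ.symm u)
  have ha : DifferentiableAt ℝ (fun v => a (φ.symm v)) u :=
    (contMDiffAt_iff_contDiffAt.1 (a.contMDiff.contMDiffAt.comp u
      (contMDiffAt_symm_of_mem_maximalAtlas hφ hu))).differentiableAt (n := ∞) (by simp)
  have e := coordDiv_smul (g := g.components φ) (differentiableAt_localHom hφ θ hu) ha
  have e1 : localHom φ u (δ (ofFun a * θ) - ofFun a * δ θ) =
      ∑ i, ∑ j, ((g.components φ u)⁻¹ i j * pderiv j (fun v => a (φ.symm v)) u) •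
        intProd i (localHom φ u θ) := by
    rw [map_sub, map_mul (localHom φ u), h.localHom_eq hφ _ hu, h.localHom_eq hφ _ hu]
    simp only [map_mul (localHom φ _), localHom_ofFun, ← Algebra.smul_def]
    rw [e, add_sub_cancel_left]
  rw [pairing, ← algebraMapInv_localHom, e1, localHom_of_eq_ι hα, hα,
    ExteriorAlgebra.ι_leftInverse, Metric.inv,
    toDual_symm_pairing_eq_sum _ (g.symm _) (chartBasis hφ hu), ← components_eq_toMatrix hφ]
  simp only [map_sum, map_smul, intProd_ι, algebraMapInv_algebraMap, smul_eq_mul]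
  refine Finset.sum_congr rfl fun i _ => Finset.sum_congr rfl fun j _ => ?_
  rw [chartBasis_apply, chartBasis_apply, pderiv, ← dAt_mfderiv hφ a hu, mul_assoc,
    mul_comm (dAt a (φ.symm u) _)]
  rfl

variable [T2Space M]

theorem pairingNondegenerate_of_inverse (h : IsInverseMetricOf δ g) : PairingNondegenerate δ := by
  intro x θ hθ h0
  rw [← ι_ιInv hθ x, g.eq_zero_of_inv (α := ExteriorAlgebra.ιInv ((θ : RoughForm n M) x)), map_zero]
  intro β
  obtain ⟨a, rfl⟩ := exists_dAt_eq x β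
  rw [← h θ hθ a x, h0]

theorem posDef_iff_of_inverse (h : IsInverseMetricOf δ g) : g.PosDef ↔ PairingPosDef δ := by
  constructor
  · intro hg x a ha
    rw [h.pairing_dFun]
    refine hg x _ fun h0 => ha ?_
    exact (LinearEquiv.map_eq_zero_iff _).1 h0
  · intro hp x v hv
    obtain ⟨a, ha⟩ := exists_dAt_eq x ((g.val x).toDual (g.nondegenerate x) v)
    have h1 := hp x a (by
      rw [ha]
      exact fun h0 => hv ((LinearEquiv.map_eq_zero_iff _).1 h0))
    rwa [h.pairing_dFun, ha, g.inv_toDual] at h1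

theorem inverse_metric_unique {g' : Metric n M} (h : IsInverseMetricOf δ g)
    (h' : IsInverseMetricOf δ g') : g = g' := by
  refine Metric.ext_of_inv fun x α β => ?_
  obtain ⟨a, rfl⟩ := exists_dAt_eq x α
  obtain ⟨b, rfl⟩ := exists_dAt_eq x β
  rw [← h.pairing_dFun, ← h'.pairing_dFun]

/-- The associated form is local. -/
theorem pairing_congr_of_eventually (h : IsBV δ) {θ η : Forms n M} {x : M}
    (hθ : ∀ᶠ y in nhds x, (θ : RoughForm n M) y = (η : RoughForm n M) y)
    (a : C^∞⟮𝓡 n, M; ℝ⟯) : pairing δ θ a x = pairing δ η a x := by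
  -- The cutoff is supported where the two forms agree, so `χθ = χη`; linearity over functions and
  -- `χ x = 1` finish.
  obtain ⟨χ, hχ, hχ'⟩ := exists_smooth_cutoff (n := n) hθ
  have e : ofFun χ * θ = ofFun χ * η := by
    refine Subtype.ext (funext fun y => ?_)
    change algebraMap ℝ _ (χ y) * (θ : RoughForm n M) y =
      algebraMap ℝ _ (χ y) * (η : RoughForm n M) y
    by_cases hy : (θ : RoughForm n M) y = (η : RoughForm n M) y
    · rw [hy]
    · rw [hχ' y hy, map_zero, zero_mul, zero_mul]
  have h1 := pairing_ofFun_mul h χ θ a x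
  rw [e, pairing_ofFun_mul h, hχ, one_mul, one_mul] at h1
  exact h1.symm

/-- Near a point, a `1`-form is a combination of differentials of functions. -/
theorem exists_local_expansion {θ : Forms n M} (hθ : θ ∈ formsOfDegree n M 1) (x : M) :
    ∃ (c b : Fin n → C^∞⟮𝓡 n, M; ℝ⟯), (∀ᶠ y in nhds x, (θ : RoughForm n M) y =
      ((∑ i, ofFun (c i) * dFun (b i) : Forms n M) : RoughForm n M) y) ∧
      ((θ : RoughForm n M) x = 0 → ∀ i, c i x = 0) := by
  obtain ⟨φ, hφ, u, hu, rfl⟩ := exists_chart_point (n := n) x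
  choose b hb using fun i => exists_coordinate hφ hu (coframe n i)
  -- The coefficients `θ(∂ᵢ)` in the chart; they vanish at the point when `θ` does.
  let f : Fin n → Coord n → ℝ := fun i v =>
    ExteriorAlgebra.algebraMapInv (intProd i (localHom φ v θ))
  have hf : ∀ i, ContDiffOn ℝ ∞ (f i) φ.target := fun i v hv => by
    let L : CoordAlg n →ₗ[ℝ] ℝ := ExteriorAlgebra.algebraMapInv.toLinearMap ∘ₗ intProd i
    exact ((LinearMap.toContinuousLinearMap L).contDiff.contDiffAt.comp v
      (contDiffAt_localForm hφ θ hv)).contDiffWithinAt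
  have hfM : ∀ i, ContMDiffOn (𝓡 n) 𝓘(ℝ, ℝ) ∞ (fun y => f i (φ y)) φ.source := fun i =>
    (contMDiffOn_iff_contDiffOn.2 (hf i)).comp (contMDiffOn_of_mem_maximalAtlas hφ)
      fun y hy => φ.map_source hy
  choose c hc using fun i => exists_smooth_eventuallyEq φ.open_source (φ.map_target hu) (hfM i)
  refine ⟨c, b, ?_, fun h0 i => ?_⟩
  · have key : ∀ᶠ v in nhds u, localHom φ v θ = localHom φ v (∑ i, ofFun (c i) * dFun (b i)) := by
      filter_upwards [Filter.eventually_all.2 hb, φ.open_target.mem_nhds hu,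
        Filter.eventually_all.2 fun i => eventuallyEq_comp_symm hu (hc i)] with v hbv hv hcv
      obtain ⟨α, hα⟩ := exists_eq_ι hθ (φ.symm v)
      have hbι : ∀ i, localHom φ v (dFun (b i)) = ExteriorAlgebra.ι ℝ (coframe n i) := fun i => by
        rw [localHom_of_eq_ι (α := dAt (b i) (φ.symm v)) rfl]
        congr 1
        exact LinearMap.ext fun X => hbv i X
      rw [map_sum]
      simp only [map_mul, hbι, localHom_ofFun, hcv, φ.right_inv hv, f]
      rw [localHom_of_eq_ι hα]
      simp only [intProd_ι, algebraMapInv_algebraMap, ← Algebra.smul_def]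
      conv_lhs => rw [← sum_apply_frame_smul_coframe (Module.Dual.transpose (R := ℝ)
        (M := Coord n) (M' := TangentSpace (𝓡 n) (φ.symm v))
        (mfderiv (𝓡 n) (𝓡 n) φ.symm v).toLinearMap α)]
      simp only [map_sum, map_smul]
    have h1 : ∀ᶠ y in nhds (φ.symm u), y ∈ φ.source ∧ localHom φ (φ y) θ =
        localHom φ (φ y) (∑ i, ofFun (c i) * dFun (b i)) := by
      refine (φ.open_source.eventually_mem (φ.map_target hu)).and ?_
      have h2 := φ.continuousAt (φ.map_target hu)
      rw [ContinuousAt, φ.right_inv hu] at h2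
      exact h2.eventually key
    filter_upwards [h1] with y hy
    have hyt := φ.map_source hy.1
    have h3 := congrArg (coMap (linMatrix (chartDeriv φ (φ y)))⁻¹) hy.2
    rw [localHom_apply, localHom_apply, coMap_inv_localForm hφ _ hyt,
      coMap_inv_localForm hφ _ hyt, φ.left_inv hy.1] at h3
    exact h3
  · rw [(hc i).eq_of_nhds]
    simp only [f]
    rw [φ.right_inv hu, localHom_apply, localForm, h0, map_zero, map_zero, map_zero]

/-- The associated form is tensorial in the `1`-form. -/
theorem pairing_congr (h : IsBV δ) {θ η : Forms n M} (hθ : θ ∈ formsOfDegree n M 1)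
    (hη : η ∈ formsOfDegree n M 1) {x : M} (hx : (θ : RoughForm n M) x = (η : RoughForm n M) x)
    (a : C^∞⟮𝓡 n, M; ℝ⟯) : pairing δ θ a x = pairing δ η a x := by
  -- The usual argument for tensoriality: near `x` the form is `∑ cᵢ dbᵢ` with all `cᵢ` zero at `x`.
  have key : ∀ ζ ∈ formsOfDegree n M 1, (ζ : RoughForm n M) x = 0 → pairing δ ζ a x = 0 := by
    intro ζ hζ h0
    obtain ⟨c, b, hcb, hc⟩ := exists_local_expansion hζ x
    rw [pairing_congr_of_eventually h hcb, pairing_sum]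
    refine Finset.sum_eq_zero fun i _ => ?_
    rw [pairing_ofFun_mul h, hc h0, zero_mul]
  have h1 := key (θ + (-1 : ℝ) • η) (Submodule.add_mem _ hθ (Submodule.smul_mem _ _ hη)) (by
    change (θ : RoughForm n M) x + (-1 : ℝ) • (η : RoughForm n M) x = 0
    rw [hx, neg_one_smul, add_neg_cancel])
  rw [pairing_add, pairing_smul] at h1
  linarith

end Pairing

/-! ### The metric of a BV structure -/

section MetricOfBV

variable {n : ℕ} {M : Type*} [TopologicalSpace M] [ChartedSpace (EuclideanSpace ℝ (Fin n)) M]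
  [IsManifold (𝓡 n) ∞ M] [T2Space M] {δ : Forms n M →ₗ[ℝ] Forms n M}

/-- Tensoriality is known in the `1`-form only; symmetry exchanges the arguments and gives it for
the function as well. -/
theorem pairing_dFun_congr (h : IsBV δ) (hs : IsSymmetricOp δ) {a a' b b' : C^∞⟮𝓡 n, M; ℝ⟯} {x : M}
    (ha : dAt a x = dAt a' x) (hb : dAt b x = dAt b' x) :
    pairing δ (dFun a) b x = pairing δ (dFun a') b' x := by
  have key : ∀ {a a' : C^∞⟮𝓡 n, M; ℝ⟯} (b : C^∞⟮𝓡 n, M; ℝ⟯), dAt a x = dAt a' x →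
      pairing δ (dFun a) b x = pairing δ (dFun a') b x := fun b ha =>
    pairing_congr h (dFun_mem _) (dFun_mem _) (congrArg (ExteriorAlgebra.ι ℝ) ha) b
  rw [key b ha, pairing_symm hs, key a' hb, pairing_symm hs]

/-- The associated form at a point, as a bilinear form on covectors. -/
theorem exists_covector_form (h : IsBV δ) (hs : IsSymmetricOp δ) (hn : PairingNondegenerate δ)
    (x : M) : ∃ H : Cotangent n M x →ₗ[ℝ] Cotangent n M x →ₗ[ℝ] ℝ,
      (∀ α β, H α β = H β α) ∧ Function.Injective H ∧
      ∀ θ ∈ formsOfDegree n M 1, ∀ a : C^∞⟮𝓡 n, M; ℝ⟯,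
        pairing δ θ a x = H (ExteriorAlgebra.ιInv ((θ : RoughForm n M) x)) (dAt a x) := by
  -- A function with each prescribed differential at `x`. The choice is immaterial since the pairing
  -- sees only differentials.
  choose e he using exists_dAt_eq (n := n) x
  have hadd : ∀ α α' β, pairing δ (dFun (e (α + α'))) (e β) x =
      pairing δ (dFun (e α)) (e β) x + pairing δ (dFun (e α')) (e β) x := fun α α' β => by
    rw [← pairing_add]
    refine pairing_congr h (dFun_mem _) (Submodule.add_mem _ (dFun_mem _) (dFun_mem _)) ?_ _
    change ExteriorAlgebra.ι ℝ (dAt (e (α + α')) x) =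
      ExteriorAlgebra.ι ℝ (dAt (e α) x) + ExteriorAlgebra.ι ℝ (dAt (e α') x)
    rw [he, he, he, map_add]
  have hsmul : ∀ (r : ℝ) α β, pairing δ (dFun (e (r • α))) (e β) x =
      r * pairing δ (dFun (e α)) (e β) x := fun r α β => by
    rw [← pairing_smul]
    refine pairing_congr h (dFun_mem _) (Submodule.smul_mem _ _ (dFun_mem _)) ?_ _
    change ExteriorAlgebra.ι ℝ (dAt (e (r • α)) x) = r • ExteriorAlgebra.ι ℝ (dAt (e α) x)
    rw [he, he, map_smul]
  have hsym : ∀ α β, pairing δ (dFun (e α)) (e β) x = pairing δ (dFun (e β)) (e α) x :=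
    fun α β => pairing_symm hs _ _ _
  let H : Cotangent n M x →ₗ[ℝ] Cotangent n M x →ₗ[ℝ] ℝ :=
    LinearMap.mk₂ ℝ (fun α β => pairing δ (dFun (e α)) (e β) x) hadd hsmul
      (fun α β β' => by rw [hsym, hadd, hsym β, hsym β'])
      (fun r α β => by rw [hsym, hsmul, hsym β]; rfl)
  have hH : ∀ θ ∈ formsOfDegree n M 1, ∀ a : C^∞⟮𝓡 n, M; ℝ⟯,
      pairing δ θ a x = H (ExteriorAlgebra.ιInv ((θ : RoughForm n M) x)) (dAt a x) := by
    intro θ hθ a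
    change _ = pairing δ (dFun (e _)) (e _) x
    rw [pairing_dFun_congr h hs (b' := a) rfl (he _)]
    refine pairing_congr h hθ (dFun_mem _) ?_ a
    change _ = ExteriorAlgebra.ι ℝ (dAt (e _) x)
    rw [he, ι_ιInv hθ]
  -- Injectivity is nondegeneracy, tested on the `1`-forms `d(e α)`.
  refine ⟨H, hsym, (injective_iff_map_eq_zero H).2 fun α hα => ?_, hH⟩
  have h0 := hn x (dFun (e α)) (dFun_mem _) fun a => by
    have h1 : ExteriorAlgebra.ιInv ((dFun (e α) : RoughForm n M) x) = α :=
      (ExteriorAlgebra.ι_leftInverse (R := ℝ) (dAt (e α) x)).trans (he α)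
    rw [hH _ (dFun_mem _), h1, hα, LinearMap.zero_apply]
  have h2 : ExteriorAlgebra.ι ℝ (dAt (e α) x) = 0 := h0
  rwa [he, ExteriorAlgebra.ι_eq_zero_iff] at h2

/-- The metric is built point by point, so only smoothness is at issue. -/
theorem exists_inverse_metric (h : IsBV δ) (hs : IsSymmetricOp δ) (hn : PairingNondegenerate δ) :
    ∃ g : Metric n M, IsInverseMetricOf δ g := by
  choose H hsym hinj hH using exists_covector_form h hs hn
  choose B hB hBs hBH using fun x => exists_inverse_form (H x) (hsym x) (hinj x)
  refine ⟨⟨B, hBs, hB, fun φ hφ i j u hu => ContDiffAt.contDiffWithinAt ?_⟩,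
    fun θ hθ a x => (hH x θ hθ a).trans (hBH x _ _).symm⟩
  choose b hb using fun i => exists_coordinate hφ hu (coframe n i)
  -- With `dbᵢ = dxⁱ` near `u`, this is the matrix `gⁱʲ` there. Its entries are read off from forms
  -- in the image of `δ`, hence smooth; the components `gᵢⱼ` are the entries of its inverse.
  let K : Coord n → Matrix (Fin n) (Fin n) ℝ := fun v =>
    Matrix.of fun i j => pairing δ (dFun (b i)) (b j) (φ.symm v)
  have hK : ∀ i j, ContDiffAt ℝ ∞ (fun v => K v i j) u := fun i j => by
    have e : (fun v => K v i j) = fun v => ExteriorAlgebra.algebraMapInv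
        (localHom φ v (δ (ofFun (b j) * dFun (b i)) - ofFun (b j) * δ (dFun (b i)))) := by
      funext v
      rw [algebraMapInv_localHom]
      rfl
    rw [e]
    exact (LinearMap.toContinuousLinearMap
      (ExteriorAlgebra.algebraMapInv.toLinearMap : CoordAlg n →ₗ[ℝ] ℝ)).contDiff.contDiffAt.comp u
      (contDiffAt_localForm hφ
        (δ (ofFun (b j) * dFun (b i)) - ofFun (b j) * δ (dFun (b i))) hu)
  have hev : ∀ᶠ v in nhds u, ∃ hv : v ∈ φ.target,
      K v = (LinearMap.BilinForm.toMatrix (chartBasis hφ hv) (B (φ.symm v)))⁻¹ := by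
    filter_upwards [Filter.eventually_all.2 hb, φ.open_target.mem_nhds hu] with v hbv hv
    refine ⟨hv, ?_⟩
    have hd : ∀ i k, dAt (b i) (φ.symm v) (chartBasis hφ hv k) = if k = i then 1 else 0 :=
      fun i k => (hbv i (frame n k)).trans (coframe_apply_frame i k)
    ext k l
    have h1 : ExteriorAlgebra.ιInv ((dFun (b k) : RoughForm n M) (φ.symm v)) =
        dAt (b k) (φ.symm v) := ExteriorAlgebra.ι_leftInverse (R := ℝ) _
    change pairing δ (dFun (b k)) (b l) (φ.symm v) = _
    rw [hH _ _ (dFun_mem _), h1, ← hBH,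
      toDual_symm_pairing_eq_sum (hB _) (hBs _) (chartBasis hφ hv)]
    simp [hd]
  have hdet : ∀ {v : Coord n} (hv : v ∈ φ.target),
      IsUnit (LinearMap.BilinForm.toMatrix (chartBasis hφ hv) (B (φ.symm v))).det := fun hv => by
    rw [isUnit_iff_ne_zero]
    exact (LinearMap.BilinForm.nondegenerate_iff_det_ne_zero _).1 (hB _)
  have hKu : IsUnit (K u).det := by
    obtain ⟨hv, e⟩ := hev.self_of_nhds
    rw [e, Matrix.isUnit_nonsing_inv_det_iff]
    exact hdet hv
  refine (contDiffAt_matrix_inv hK hKu i j).congr_of_eventuallyEq ?_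
  filter_upwards [hev] with v hv
  obtain ⟨hv, e⟩ := hv
  rw [e, Matrix.nonsing_inv_nonsing_inv _ (hdet hv), LinearMap.BilinForm.toMatrix_apply]
  rfl

end MetricOfBV

end BVGeom
end

/-! ### The main theorem -/

open BVGeom in
theorem mainTheorem5 (n : ℕ) (M : Type*) [TopologicalSpace M]
    [ChartedSpace (EuclideanSpace ℝ (Fin n)) M] [IsManifold (𝓡 n) ∞ M]
    [T2Space M] [SecondCountableTopology M] :
    -- a metric exists iff a symmetric nondegenerate BV structure exists
    (Nonempty (Metric n M) ↔
      ∃ δ : Forms n M →ₗ[ℝ] Forms n M, IsBV δ ∧ IsSymmetricOp δ ∧ PairingNondegenerate δ) ∧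
    -- the same for positive definite metrics
    ((∃ g : Metric n M, g.PosDef) ↔
      ∃ δ : Forms n M →ₗ[ℝ] Forms n M,
        IsBV δ ∧ IsSymmetricOp δ ∧ PairingNondegenerate δ ∧ PairingPosDef δ) ∧
    -- the associated form of such a BV structure is the inverse of a unique metric
    (∀ δ : Forms n M →ₗ[ℝ] Forms n M, IsBV δ → IsSymmetricOp δ → PairingNondegenerate δ →
      (∃! g : Metric n M, IsInverseMetricOf δ g) ∧
      ∀ g : Metric n M, IsInverseMetricOf δ g → (g.PosDef ↔ PairingPosDef δ)) ∧
    -- every metric arises so from its codifferential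
    (∀ g : Metric n M, (∃! δ : Forms n M →ₗ[ℝ] Forms n M, IsCodifferential g δ) ∧
      ∀ δ : Forms n M →ₗ[ℝ] Forms n M, IsCodifferential g δ →
        IsBV δ ∧ IsSymmetricOp δ ∧ PairingNondegenerate δ ∧ IsInverseMetricOf δ g) := by
  have ha : ∀ δ : Forms n M →ₗ[ℝ] Forms n M, IsBV δ → IsSymmetricOp δ → PairingNondegenerate δ →
      ∃ g : Metric n M, IsInverseMetricOf δ g := fun δ => exists_inverse_metric
  have hb : ∀ (g : Metric n M) (δ : Forms n M →ₗ[ℝ] Forms n M), IsCodifferential g δ →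
      IsBV δ ∧ IsSymmetricOp δ ∧ PairingNondegenerate δ ∧ IsInverseMetricOf δ g := fun g δ h =>
    ⟨h.isBV, isSymmetricOp_of_inverse h.isBV h.isInverseMetricOf,
      pairingNondegenerate_of_inverse h.isInverseMetricOf, h.isInverseMetricOf⟩
  refine ⟨⟨?_, ?_⟩, ⟨?_, ?_⟩, fun δ h hs hn => ⟨?_, fun g hg => posDef_iff_of_inverse hg⟩,
    fun g => ⟨⟨codiff g, isCodifferential_codiff g, fun δ h => h.unique (isCodifferential_codiff g)⟩,
      hb g⟩⟩
  · rintro ⟨g⟩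
    obtain ⟨h, hs, hn, -⟩ := hb g _ (isCodifferential_codiff g)
    exact ⟨_, h, hs, hn⟩
  · rintro ⟨δ, h, hs, hn⟩
    exact ⟨(ha δ h hs hn).choose⟩
  · rintro ⟨g, hg⟩
    obtain ⟨h, hs, hn, hi⟩ := hb g _ (isCodifferential_codiff g)
    exact ⟨_, h, hs, hn, (posDef_iff_of_inverse hi).1 hg⟩
  · rintro ⟨δ, h, hs, hn, hp⟩
    obtain ⟨g, hg⟩ := ha δ h hs hn
    exact ⟨g, (posDef_iff_of_inverse hg).2 hp⟩
  · obtain ⟨g, hg⟩ := ha δ h hs hn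
    exact ⟨g, hg, fun g' hg' => inverse_metric_unique hg' hg⟩
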